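/- Let $S$ be a metric space with its Borel sets and let $B$ be a sub-stochastic kernel on $S$, i.e. a kernel of non-negative measures with $B(x,S)\le 1$ for all $x\in S$. Suppose there are a probability $\nu$ on $S$, an integer $m\ge 1$ and a positive density $b_m$ with $B^m(x,dy)=b_m(x,y)\,\nu(dy)$ for all $x\in S$, and that (A4) there are $v\in S$ and constants $c_1>0$ and $c_2<\infty$ with $$c_1\le \frac{b_m(x,y)}{b_m(v,y)}\le c_2\qquad\text{for all }x,y\in S.$$ Put $\psi(C)=\int_C b_m(v,y)\,\nu(dy)\big/\int_S b_m(v,y)\,\nu(dy)$, $\delta=c_1\int_S b_m(v,y)\,\nu(dy)$ and $\tilde B(x,\cdot)=B^m(x,\cdot)-\delta\psi\ge 0$. Let $(X_{km})_{k\ge 0}$ be the Markov chain on $S\cup\{\Delta\}$, with $\Delta$ absorbing, which from $x\in S$ regenerates, i.e. moves to a $\psi$-distributed point, with probability $\delta$, moves according to $\tilde B(x,dy)$ without regenerating, and moves to $\Delta$ with the remaining probability $1-B^m(x,S)$ (so the transition kernel of this chain on $S$ is $B^m$). Let $\tau$ be the first $k\ge 1$ such that the $k$-th transition is a regeneration,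 and for $k\ge 0$ write $\{T>km\}$ for the event $X_{0},X_{m},\dots,X_{km}\ne\Delta$. Write $E_x$ and $E_\psi$ for expectations when $X_0=x$ and when $X_0$ has law $\psi$; here $I(T>\tau m)$ means $\sum_{k\ge1}I(\tau=k,\,T>km)$. Then there is $\theta\ge 0$ with $E_\psi e^{\theta\tau}I(T>\tau m)=1$ and $E_\psi\tau e^{\theta\tau}I(T>\tau m)<\infty$. Moreover, for every $\theta\ge 0$ with $E_\psi e^{\theta\tau}I(T>\tau m)=1$, put $$\lambda_*=e^{-\theta},\qquad u_*(x)=E_xe^{\theta\tau}I(T>\tau m),\qquad \eta_*(C)=E_\psi\sum_{j=0}^{\tau-1}e^{\theta j}I(X_{jm}\in C,\,T>jm)$$ for $x\in S$ and measurable $C\subseteq S$. Then $0<u_*(x)<\infty$ for all $x\in S$, $\eta_*$ is a finite measure, $0<\int_S u_*\,d\eta_*<\infty$, and for every $x\in S$ and every measurable $C\subseteq S$ with $\eta_*(C)>0$, $$B^n(x,C)\sim\lambda_*^{n/m}\,\frac{u_*(x)\,\eta_*(C)}{\int_S u_*(w)\,\eta_*(dw)}\qquad(n\to\infty).$$ 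-/

import Mathlib

open MeasureTheory ProbabilityTheory Filter Asymptotics
open scoped ENNReal

noncomputable section

/-- A sub-stochastic kernel `B` on a metric space `S` (with its Borel sets), some power `B ^ m`
(`m ≥ 1`) of which has a positive density `b` with respect to a probability `ν`:
`B ^ m (x, dy) = b x y ν(dy)`. -/
structure DensityKernel (S : Type*) [MetricSpace S] [MeasurableSpace S] [BorelSpace S] where
  B : Kernel S S
  B_le_one : ∀ x, B x Set.univ ≤ 1
  ν : Measure S
  ν_prob : IsProbabilityMeasure ν
  m : ℕ
  one_le_m : 1 ≤ m
  b : S → S → ℝ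
  b_pos : ∀ x y, 0 < b x y
  b_meas : ∀ x, Measurable (b x)
  B_pow : ∀ x, (B ^ m) x = ν.withDensity (fun y => ENNReal.ofReal (b x y))

/-- The uniform comparability assumption: there are a point `v` and constants `0 < c₁`, `c₂ < ∞`
with `c₁ ≤ b x y / b v y ≤ c₂` for all `x, y`. -/
structure UniformComparison {S : Type*} [MetricSpace S] [MeasurableSpace S] [BorelSpace S]
    (D : DensityKernel S) where
  v : S
  c₁ : ℝ
  c₂ : ℝ
  c₁_pos : 0 < c₁
  lower : ∀ x y, c₁ ≤ D.b x y / D.b v y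
  upper : ∀ x y, D.b x y / D.b v y ≤ c₂

/-- The state space `S ∪ {Δ}`, where `Δ` is the cemetery `Sum.inr ()`, together with a mark that
records whether the last transition was a regeneration. -/
abbrev MarkedState (S : Type*) : Type _ := (S ⊕ Unit) × Bool

/-- A trajectory of the marked chain. The state at time `k` stands for `X_{km}`. -/
abbrev MarkedPath (S : Type*) : Type _ := ℕ → MarkedState S

namespace MarkedPath

variable {S : Type*}

/-- `τ`: the first `k ≥ 1` such that the `k`-th transition is a regeneration (`∞` if none). -/
def regenTime (ω : MarkedPath S) : ℕ∞ := ⨅ (k : ℕ) (_ : 1 ≤ k ∧ (ω k).2 = true), (k : ℕ∞)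

/-- The first `k ≥ 0` with `X_{km} = Δ` (`∞` if none). As `Δ` is absorbing, the hitting time `T`
of `Δ` by `(X_n)` satisfies `T > k m` if and only if `ω.deathTime > k`. -/
def deathTime (ω : MarkedPath S) : ℕ∞ := ⨅ (k : ℕ) (_ : (ω k).1 = Sum.inr ()), (k : ℕ∞)

open Classical in
/-- `w(τ) I(T > τ m)`, understood as `∑_{k ≥ 1} w(k) I(τ = k, T > k m)`. -/
def atRegen (w : ℕ → ℝ≥0∞) (ω : MarkedPath S) : ℝ≥0∞ :=
  ∑' k : ℕ, if ω.regenTime = k ∧ (k : ℕ∞) < ω.deathTime then w k else 0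

open Classical in
/-- `∑_{j = 0}^{τ - 1} w(j) I(X_{jm} ∈ C, T > j m)`. -/
def occupation (w : ℕ → ℝ≥0∞) (C : Set S) (ω : MarkedPath S) : ℝ≥0∞ :=
  ∑' j : ℕ, if (j : ℕ∞) < ω.regenTime ∧ (ω j).1 ∈ Sum.inl '' C ∧ (j : ℕ∞) < ω.deathTime
    then w j else 0

lemma lt_regenTime_iff (ω : MarkedPath S) (j : ℕ) :
    (j : ℕ∞) < ω.regenTime ↔ ∀ k ≤ j, ¬ (1 ≤ k ∧ (ω k).2 = true) := by
  rw [← ENat.add_one_le_iff (ENat.natCast_ne_top j)]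
  simp only [regenTime, le_iInf_iff]
  constructor
  · intro h k hk hk'
    have := h k hk'
    norm_cast at this
    omega
  · intro h k hk
    norm_cast
    by_contra hlt
    exact h k (by omega) hk

lemma lt_deathTime_iff (ω : MarkedPath S) (j : ℕ) :
    (j : ℕ∞) < ω.deathTime ↔ ∀ k ≤ j, ¬ (ω k).1 = Sum.inr () := by
  rw [← ENat.add_one_le_iff (ENat.natCast_ne_top j)]
  simp only [deathTime, le_iInf_iff]
  constructor
  · intro h k hk hk'
    have := h k hk'
    norm_cast at this
    omega
  · intro h k hk
    norm_cast
    by_contra hlt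
    exact h k (by omega) hk

lemma occupation_empty (w : ℕ → ℝ≥0∞) (ω : MarkedPath S) : occupation w ∅ ω = 0 := by
  simp [occupation]

lemma occupation_iUnion (w : ℕ → ℝ≥0∞) {f : ℕ → Set S} (hf : Pairwise (Function.onFun Disjoint f))
    (ω : MarkedPath S) : occupation w (⋃ i, f i) ω = ∑' i, occupation w (f i) ω := by
  classical
  unfold occupation
  rw [ENNReal.tsum_comm]
  congr 1
  ext j
  by_cases h : ∃ i, (ω j).1 ∈ Sum.inl '' (f i)
  · obtain ⟨i, hi⟩ := h
    rw [tsum_eq_single i]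
    · have hU : (ω j).1 ∈ Sum.inl '' (⋃ i, f i) := by
        rw [Set.image_iUnion]; exact Set.mem_iUnion.2 ⟨i, hi⟩
      simp only [hU, hi]
    · intro i' hne
      have : (ω j).1 ∉ Sum.inl '' (f i') := by
        rintro ⟨y, hy, hy'⟩
        obtain ⟨z, hz, hz'⟩ := hi
        have : y = z := Sum.inl_injective (hy'.trans hz'.symm)
        subst this
        exact Set.disjoint_left.1 (hf hne) hy hz
      simp [this]
  · have hU : (ω j).1 ∉ Sum.inl '' (⋃ i, f i) := by
      rw [Set.image_iUnion]; simpa using h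
    push Not at h
    simp only [hU, h]
    simp

variable [MeasurableSpace S]

lemma measurableSet_lt_regenTime (j : ℕ) :
    MeasurableSet {ω : MarkedPath S | (j : ℕ∞) < ω.regenTime} := by
  simp only [lt_regenTime_iff, Set.ofPred_forall]
  refine MeasurableSet.iInter fun k => MeasurableSet.iInter fun _ => ?_
  by_cases h : 1 ≤ k
  · simp only [h, true_and]
    exact ((measurable_snd.comp (measurable_pi_apply k)) (measurableSet_singleton true)).compl
  · simp [h]

lemma measurableSet_lt_deathTime (j : ℕ) :
    MeasurableSet {ω : MarkedPath S | (j : ℕ∞) < ω.deathTime} := by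
  simp only [lt_deathTime_iff, Set.ofPred_forall]
  refine MeasurableSet.iInter fun k => MeasurableSet.iInter fun _ => ?_
  have h : MeasurableSet (Set.range (Sum.inr : Unit → S ⊕ Unit)) := measurableSet_range_inr
  have h' := ((measurable_fst.comp (measurable_pi_apply k)) h :
    MeasurableSet ((Prod.fst ∘ fun ω : MarkedPath S => ω k) ⁻¹' _)).compl
  convert h' using 1
  ext ω
  simp only [Set.mem_compl_iff, Set.mem_preimage, Function.comp_apply, Set.mem_range]
  exact not_congr ⟨fun e => ⟨(), e.symm⟩, fun ⟨_, e⟩ => e.symm⟩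

lemma measurable_occupation (w : ℕ → ℝ≥0∞) {C : Set S} (hC : MeasurableSet C) :
    Measurable (occupation w C) := by
  classical
  unfold occupation
  refine Measurable.tsum fun j => Measurable.ite ?_ measurable_const measurable_const
  exact (measurableSet_lt_regenTime j).inter
    (((measurable_fst.comp (measurable_pi_apply j)) (measurableSet_inl_image.2 hC)).inter
      (measurableSet_lt_deathTime j))

end MarkedPath

namespace UniformComparison

variable {S : Type*} [MetricSpace S] [MeasurableSpace S] [BorelSpace S]
  {D : DensityKernel S} (A : UniformComparison D)

/-- `∫ b(v, y) ν(dy)`. -/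
def mass : ℝ≥0∞ := ∫⁻ y, ENNReal.ofReal (D.b A.v y) ∂D.ν

/-- `ψ(C) = ∫_C b(v, y) ν(dy) / ∫ b(v, y) ν(dy)`. -/
def psi : Measure S := A.mass⁻¹ • D.ν.withDensity (fun y => ENNReal.ofReal (D.b A.v y))

/-- `δ = c₁ ∫ b(v, y) ν(dy)`. -/
def delta : ℝ≥0∞ := ENNReal.ofReal A.c₁ * A.mass

lemma mass_eq : A.mass = (D.B ^ D.m) A.v Set.univ := by
  rw [D.B_pow, withDensity_apply _ MeasurableSet.univ]
  simp [mass]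

lemma pow_le_one (n : ℕ) (x : S) : (D.B ^ n) x Set.univ ≤ 1 := by
  induction n generalizing x with
  | zero =>
    rw [pow_zero]
    change (Kernel.id : Kernel S S) x Set.univ ≤ 1
    simp [Kernel.id_apply]
  | succ n ih =>
    rw [Kernel.pow_succ_apply_eq_lintegral _ _ _ MeasurableSet.univ]
    refine (lintegral_mono fun y => ?_).trans (b := ∫⁻ _, 1 ∂((D.B ^ n) x)) ?_
    · exact D.B_le_one y
    · simpa using ih x

lemma mass_ne_top : A.mass ≠ ⊤ := by
  rw [mass_eq]
  exact ne_top_of_le_ne_top ENNReal.one_ne_top (pow_le_one _ _)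

lemma mass_ne_zero : A.mass ≠ 0 := by
  have := D.ν_prob
  intro h
  have hm : Measurable fun y => ENNReal.ofReal (D.b A.v y) :=
    ENNReal.measurable_ofReal.comp (D.b_meas _)
  rw [mass, lintegral_eq_zero_iff hm] at h
  obtain ⟨y, hy⟩ := h.exists
  have := D.b_pos A.v y
  simp at hy
  linarith

instance : IsProbabilityMeasure A.psi := by
  constructor
  rw [psi, Measure.smul_apply, withDensity_apply _ MeasurableSet.univ, Measure.restrict_univ]
  exact ENNReal.inv_mul_cancel A.mass_ne_zero A.mass_ne_top

lemma delta_smul_psi : A.delta • A.psi =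
    ENNReal.ofReal A.c₁ • D.ν.withDensity (fun y => ENNReal.ofReal (D.b A.v y)) := by
  rw [delta, psi, smul_smul, mul_assoc, ENNReal.mul_inv_cancel A.mass_ne_zero A.mass_ne_top,
    mul_one]

lemma delta_smul_psi_le (x : S) : A.delta • A.psi ≤ (D.B ^ D.m) x := by
  have hm : Measurable fun y => ENNReal.ofReal (D.b A.v y) :=
    ENNReal.measurable_ofReal.comp (D.b_meas _)
  rw [delta_smul_psi, D.B_pow, ← withDensity_smul _ hm]
  refine withDensity_mono (Filter.Eventually.of_forall fun y => ?_)
  have h := A.lower x y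
  rw [le_div_iff₀ (D.b_pos _ _)] at h
  simp only [Pi.smul_apply, smul_eq_mul]
  rw [← ENNReal.ofReal_mul A.c₁_pos.le]
  exact ENNReal.ofReal_le_ofReal h

instance : IsFiniteMeasure (A.delta • A.psi) := by
  constructor
  refine lt_of_le_of_lt (A.delta_smul_psi_le A.v Set.univ) ?_
  exact lt_of_le_of_lt (pow_le_one _ _) ENNReal.one_lt_top

/-- The kernel `B̃` in the decomposition `B ^ m (x, ·) = δ ψ + B̃(x, ·)`. -/
def residual : Kernel S S where
  toFun x := (D.B ^ D.m) x - A.delta • A.psi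
  measurable' := by
    refine Measure.measurable_of_measurable_coe _ fun s hs => ?_
    simp_rw [Measure.sub_apply hs (A.delta_smul_psi_le _)]
    exact (Kernel.measurable_coe _ hs).sub_const _

lemma residual_add (x : S) : A.residual x + A.delta • A.psi = (D.B ^ D.m) x :=
  Measure.sub_add_cancel_of_le (A.delta_smul_psi_le x)

/-- One step of the marked chain. From `x ∈ S`: with probability `δ` the chain regenerates, that
is, it moves to a point distributed according to `ψ`; with probability `B̃(x, dy)` it moves to `y`
without regenerating; with the remaining probability `1 - B ^ m (x, S)` it moves to `Δ`.
The state `Δ` is absorbing. -/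
def stepMeasure (x : S ⊕ Unit) : Measure (MarkedState S) :=
  x.elim
    (fun x => A.delta • A.psi.map (fun y => (Sum.inl y, true))
      + (A.residual x).map (fun y => (Sum.inl y, false))
      + (1 - (D.B ^ D.m) x Set.univ) • Measure.dirac (Sum.inr (), false))
    (fun _ => Measure.dirac (Sum.inr (), false))

lemma measurable_stepMeasure : Measurable A.stepMeasure := by
  have hf : Measurable (fun y : S => ((Sum.inl y, false) : MarkedState S)) :=
    measurable_inl.prodMk measurable_const
  refine measurable_fun_sum ?_ measurable_const
  refine Measure.measurable_of_measurable_coe _ fun s hs => ?_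
  simp only [Function.comp_def, stepMeasure, Sum.elim_inl, Measure.add_apply,
    Measure.smul_apply, Measure.map_apply hf hs, smul_eq_mul]
  refine (measurable_const.add (Kernel.measurable_coe _ (hf hs))).add ?_
  exact ((Kernel.measurable_coe _ MeasurableSet.univ).const_sub 1).mul_const _

/-- Forgetting the marks, the chain moves on `S` according to `B ^ m`. -/
lemma stepMeasure_inl (x : S) {C : Set S} (hC : MeasurableSet C) :
    A.stepMeasure (Sum.inl x) (Prod.fst ⁻¹' (Sum.inl '' C)) = (D.B ^ D.m) x C := by
  have ht : Measurable (fun y : S => ((Sum.inl y, true) : MarkedState S)) :=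
    measurable_inl.prodMk measurable_const
  have hf : Measurable (fun y : S => ((Sum.inl y, false) : MarkedState S)) :=
    measurable_inl.prodMk measurable_const
  have hs : MeasurableSet (Prod.fst ⁻¹' (Sum.inl '' C) : Set (MarkedState S)) :=
    measurable_fst (measurableSet_inl_image.2 hC)
  have h := congrArg (fun μ : Measure S => μ C) (A.residual_add x)
  simp only [Measure.add_apply, Measure.smul_apply, smul_eq_mul] at h
  have hC' : (Sum.inl ⁻¹' ((Sum.inl : S → S ⊕ Unit) '' C)) = C :=
    Set.preimage_image_eq _ Sum.inl_injective
  simp only [stepMeasure, Sum.elim_inl, Measure.add_apply, Measure.smul_apply,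
    Measure.map_apply hf hs, Measure.map_apply ht hs, Measure.dirac_apply' _ hs, smul_eq_mul,
    Set.preimage_preimage, hC']
  rw [← h, add_comm (A.residual x C)]
  simp

/-- The transition kernel of the marked chain. -/
def step : Kernel (MarkedState S) (MarkedState S) where
  toFun s := A.stepMeasure s.1
  measurable' := A.measurable_stepMeasure.comp measurable_fst

instance : IsMarkovKernel A.step := by
  constructor
  rintro ⟨x | x, i⟩
  · constructor
    have ht : Measurable (fun y : S => ((Sum.inl y, true) : MarkedState S)) :=
      measurable_inl.prodMk measurable_const
    have hf : Measurable (fun y : S => ((Sum.inl y, false) : MarkedState S)) :=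
      measurable_inl.prodMk measurable_const
    change A.stepMeasure (Sum.inl x) Set.univ = 1
    simp only [stepMeasure, Sum.elim_inl, Measure.add_apply, Measure.smul_apply,
      Measure.map_apply hf MeasurableSet.univ, Measure.map_apply ht MeasurableSet.univ,
      Set.preimage_univ, smul_eq_mul, measure_univ, mul_one]
    have h := congrArg (fun μ : Measure S => μ Set.univ) (A.residual_add x)
    simp only [Measure.add_apply, Measure.smul_apply, measure_univ, smul_eq_mul, mul_one] at h
    rw [add_comm A.delta, h]
    exact add_tsub_cancel_of_le (pow_le_one _ _)
  · change IsProbabilityMeasure (A.stepMeasure (Sum.inr x))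
    simp only [stepMeasure, Sum.elim_inr]
    infer_instance

/-- The law of the marked chain with `X_0` distributed according to `μ`. -/
def pathLaw (μ : Measure S) : Measure (MarkedPath S) :=
  Kernel.trajMeasure (X := fun _ => MarkedState S) (μ.map (fun x => (Sum.inl x, false)))
    (fun n => A.step.comap (fun h => h ⟨n, Finset.mem_Iic.2 le_rfl⟩) (measurable_pi_apply _))

/-- `E_ψ e^{θ τ} I(T > τ m)`. -/
def regenTransform (θ : ℝ) : ℝ≥0∞ :=
  ∫⁻ ω, MarkedPath.atRegen (fun k => ENNReal.ofReal (Real.exp (θ * k))) ω ∂A.pathLaw A.psi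

/-- `E_ψ τ e^{θ τ} I(T > τ m)`. -/
def regenMean (θ : ℝ) : ℝ≥0∞ :=
  ∫⁻ ω, MarkedPath.atRegen (fun k => k * ENNReal.ofReal (Real.exp (θ * k))) ω ∂A.pathLaw A.psi

/-- `λ_* = e^{-θ}`. -/
def lambdaStar (θ : ℝ) : ℝ := Real.exp (-θ)

/-- `u_*(x) = E_x e^{θ τ} I(T > τ m)`. -/
def uStar (θ : ℝ) (x : S) : ℝ≥0∞ :=
  ∫⁻ ω, MarkedPath.atRegen (fun k => ENNReal.ofReal (Real.exp (θ * k))) ω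
    ∂A.pathLaw (Measure.dirac x)

/-- `η_*(C) = E_ψ ∑_{j = 0}^{τ - 1} e^{θ j} I(X_{jm} ∈ C, T > j m)`. -/
def etaStar (θ : ℝ) : Measure S :=
  Measure.ofMeasurable
    (fun C _ => ∫⁻ ω, MarkedPath.occupation (fun j => ENNReal.ofReal (Real.exp (θ * j))) C ω
      ∂A.pathLaw A.psi)
    (by simp [MarkedPath.occupation_empty])
    (fun f hf hd => by
      simp_rw [MarkedPath.occupation_iUnion _ hd]
      exact lintegral_tsum fun i => (MarkedPath.measurable_occupation _ (hf i)).aemeasurable)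

end UniformComparison

end

/-! Put `P = B ^ m`. Assumption (A4) bounds `P` on both sides by multiples of one measure: `δ ψ ≤ P
x ≤ (c₂ / c₁) δ ψ` for every `x`. Everything rests on these two bounds.

Existence of `θ`. On an excursion the chain moves by `B̃`, and every living state regenerates with
the same probability `δ`, so `a n = P_ψ(τ = n, T > n m)` is `δ` times the mass of `ψ B̃ ^ (n - 1)`.
The upper bound lets each excursion step be replaced by a restart from `ψ`, whence `a (i + j) ≤ L a
i a j` with `L = c₂ / c₁`. Summing over `i + j = n` shows that the partial sums of `∑ n a n s ^ n`
are at most `1 + L` as long as those of `∑ a n s ^ n` are at most `1`. The generating function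
therefore cannot jump over the value `1` at its radius of convergence, and at the solution the mean
is finite.

Asymptotics. When the transform equals `1`, decomposing at the first step and at the last step of an
excursion shows that `u_*` is a right eigenfunction and `η_*` a left eigenmeasure of `P`, both with
eigenvalue `e^{-θ}`; the two bounds keep `u_*` away from `0` and `∞`. Relative to `u_*`, the
minorization by `δ ψ` shrinks the oscillation of `e^{θ k} P ^ k f` by a fixed factor at each step,
and integration against `η_*` identifies the limit (`exists_forall_abs_pow_integral_sub_le`). This
contraction takes the place of a renewal theorem, so the finite mean is not needed here.

From `P` to `B`. Since `B` commutes with `P`, the function `B u_*` is again an eigenfunction of `P`,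
and the convergence just obtained makes it a multiple of `u_*`; thus `B u_* = e^{-θ / m} u_*`
(`integral_uStar`). For `n = m q + r`, the first `r` steps are absorbed by this identity and the
other `q` blocks by the uniform convergence. -/

/-! ### Submultiplicative sequences and exponential tilting. -/

/-- A sequence with `f (i + j) ≤ L * f i * f j` has truncated first moments controlled by its
truncated sums. -/
lemma sum_nat_mul_le_of_submultiplicative {f : ℕ → ℝ} {L : ℝ} (hL : 0 ≤ L) (hf : ∀ n, 0 ≤ f n)
    (hsub : ∀ i j, 1 ≤ i → 1 ≤ j → f (i + j) ≤ L * (f i * f j)) (N : ℕ) :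
    ∑ n ∈ Finset.range N, n * f n ≤
      ∑ n ∈ Finset.range N, f n + L * (∑ n ∈ Finset.range N, f n) ^ 2 := by
  -- Each of the `n - 1` splittings of `n` into two positive parts bounds `f n` once; the two
  -- splittings with a zero part are nonnegative and discarded.
  have h1 : ∀ n : ℕ, n * f n ≤ f n + L * ∑ p ∈ Finset.HasAntidiagonal.antidiagonal n, f p.1 * f p.2 := by
    intro n
    rw [Finset.Nat.sum_antidiagonal_eq_sum_range_succ (fun i j => f i * f j)]
    rcases n with _ | n
    · have := hf 0
      simp only [Nat.cast_zero, zero_mul]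
      exact add_nonneg this (mul_nonneg hL (Finset.sum_nonneg fun i _ => mul_nonneg (hf _) (hf _)))
    · rw [Finset.sum_range_succ, Finset.sum_range_succ', mul_add, mul_add, Finset.mul_sum]
      have hterm : ∀ i ∈ Finset.range n, f (n + 1) ≤ L * (f (i + 1) * f (n + 1 - (i + 1))) := by
        intro i hi
        have hi := Finset.mem_range.1 hi
        have := hsub (i + 1) (n + 1 - (i + 1)) (by omega) (by omega)
        rwa [show i + 1 + (n + 1 - (i + 1)) = n + 1 by omega] at this
      have h := Finset.sum_le_sum hterm
      rw [Finset.sum_const, Finset.card_range, nsmul_eq_mul] at h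
      have h2 : 0 ≤ L * (f 0 * f (n + 1 - 0)) := mul_nonneg hL (mul_nonneg (hf _) (hf _))
      have h3 : 0 ≤ L * (f (n + 1) * f (n + 1 - (n + 1))) :=
        mul_nonneg hL (mul_nonneg (hf _) (hf _))
      rw [Nat.cast_succ]
      linarith
  -- The antidiagonals below `N` fill a triangle inside the square `[0, N) × [0, N)`.
  have h2 : ∑ n ∈ Finset.range N, ∑ p ∈ Finset.HasAntidiagonal.antidiagonal n, f p.1 * f p.2 ≤
      (∑ n ∈ Finset.range N, f n) ^ 2 := by
    set T : Finset (ℕ × ℕ) :=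
      (Finset.range N ×ˢ Finset.range N).filter (fun p => p.1 + p.2 ∈ Finset.range N) with hT
    have hfib := Finset.sum_fiberwise_of_maps_to (s := T) (t := Finset.range N)
      (g := fun p => p.1 + p.2) (fun p hp => (Finset.mem_filter.1 hp).2) (fun p => f p.1 * f p.2)
    have heq : ∀ n ∈ Finset.range N, T.filter (fun p => p.1 + p.2 = n) =
        Finset.HasAntidiagonal.antidiagonal n := by
      intro n hn
      ext p
      simp only [hT, Finset.mem_filter, Finset.mem_product, Finset.mem_range,
        Finset.HasAntidiagonal.mem_antidiagonal] at hn ⊢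
      omega
    rw [Finset.sum_congr rfl fun n hn => by rw [← heq n hn], hfib, sq, Finset.sum_mul_sum,
      ← Finset.sum_product']
    exact Finset.sum_le_sum_of_subset_of_nonneg (Finset.filter_subset _ _)
      fun p _ _ => mul_nonneg (hf _) (hf _)
  calc ∑ n ∈ Finset.range N, n * f n
      ≤ ∑ n ∈ Finset.range N, (f n + L * ∑ p ∈ Finset.HasAntidiagonal.antidiagonal n, f p.1 * f p.2) :=
        Finset.sum_le_sum fun n _ => h1 n
    _ = ∑ n ∈ Finset.range N, f n +
        L * ∑ n ∈ Finset.range N, ∑ p ∈ Finset.HasAntidiagonal.antidiagonal n, f p.1 * f p.2 := by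
        rw [Finset.sum_add_distrib, Finset.mul_sum]
    _ ≤ _ := by gcongr

/-- A submultiplicative defective probability sequence becomes a probability sequence with finite
mean after an exponential change of measure. -/
lemma exists_hasSum_mul_pow_eq_one {a : ℕ → ℝ} {L : ℝ} (hL : 0 ≤ L) (ha : ∀ n, 0 ≤ a n)
    (ha1 : 0 < a 1) (hsum : ∀ N, ∑ n ∈ Finset.range N, a n ≤ 1)
    (hsub : ∀ i j, 1 ≤ i → 1 ≤ j → a (i + j) ≤ L * (a i * a j)) :
    ∃ s : ℝ, 1 ≤ s ∧ HasSum (fun n => a n * s ^ n) 1 ∧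
      ∀ N, ∑ n ∈ Finset.range N, n * (a n * s ^ n) ≤ 1 + L := by
  set F : ℕ → ℝ → ℝ := fun N s => ∑ n ∈ Finset.range N, a n * s ^ n with hF
  have hFcont : ∀ N, Continuous (F N) := fun N => by fun_prop
  have hmean : ∀ (s : ℝ), 0 ≤ s → ∀ N, F N s ≤ 1 →
      ∑ n ∈ Finset.range N, n * (a n * s ^ n) ≤ 1 + L := by
    intro s hs N hN
    have h := sum_nat_mul_le_of_submultiplicative (f := fun n => a n * s ^ n) hL
      (fun n => mul_nonneg (ha n) (pow_nonneg hs n)) (fun i j hi hj => by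
        have := mul_le_mul_of_nonneg_right (hsub i j hi hj) (pow_nonneg hs (i + j))
        calc _ ≤ _ := this
          _ = _ := by ring) N
    have h0 : 0 ≤ F N s := Finset.sum_nonneg fun n _ => mul_nonneg (ha n) (pow_nonneg hs n)
    have h1 : F N s ^ 2 ≤ 1 := pow_le_one₀ h0 hN
    calc _ ≤ F N s + L * F N s ^ 2 := h
      _ ≤ 1 + L * 1 := by gcongr
      _ = 1 + L := by ring
  -- The solution will be `sSup E`; `E` is bounded because `F 2 s` already contains the term `a 1 *
  -- s`.
  set E : Set ℝ := {s | 1 ≤ s ∧ ∀ N, F N s ≤ 1} with hE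
  have hE1 : (1 : ℝ) ∈ E := ⟨le_rfl, fun N => by simpa [hF] using hsum N⟩
  have hEb : BddAbove E := by
    refine ⟨1 / a 1, fun s hs => ?_⟩
    rw [le_div_iff₀ ha1]
    have h := hs.2 2
    simp only [hF, Finset.sum_range_succ, Finset.sum_range_zero] at h
    have := ha 0
    linarith
  have hEc : IsClosed E := by
    rw [hE, Set.ofPred_and]
    refine isClosed_Ici.inter ?_
    rw [Set.ofPred_forall]
    exact isClosed_iInter fun N => isClosed_le (hFcont N) continuous_const
  set r := sSup E with hr
  have hrE : r ∈ E := hEc.csSup_mem ⟨1, hE1⟩ hEb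
  have hr0 : 0 < r := lt_of_lt_of_le one_pos hrE.1
  -- Some partial sum exceeds `1` at `t`, so it equals `1` at some `p` in `[r, t]`. Its first moment
  -- at `p` is at most `1 + L` whatever `N` is, so going back from `p` to `r` costs little. Letting
  -- `t` decrease to `r` gives a total of at least `1` at `r`.
  have hkey : ∀ t, r < t → ∃ N, 1 - (1 + L) * (1 - r / t) ≤ F N r := by
    intro t ht
    have ht0 : 0 < t := hr0.trans ht
    have htE : t ∉ E := fun h => absurd (le_csSup hEb h) (not_le.2 ht)
    have : ∃ N, 1 < F N t := by
      by_contra hcon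
      push Not at hcon
      exact htE ⟨hrE.1.trans ht.le, hcon⟩
    obtain ⟨N, hN⟩ := this
    obtain ⟨p, hp, hFp⟩ := intermediate_value_Icc ht.le (hFcont N).continuousOn
      (show (1 : ℝ) ∈ Set.Icc (F N r) (F N t) from ⟨hrE.2 N, hN.le⟩)
    have hp0 : 0 < p := hr0.trans_le hp.1
    refine ⟨N, ?_⟩
    have hq0 : 0 ≤ r / p := by positivity
    have hqt : 1 - r / p ≤ 1 - r / t := by
      have : r / t ≤ r / p := div_le_div_of_nonneg_left hr0.le hp0 hp.2
      linarith
    have hterm : ∀ n ∈ Finset.range N, a n * p ^ n - (1 - r / p) * (n * (a n * p ^ n)) ≤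
        a n * r ^ n := by
      intro n _
      -- Bernoulli's inequality for `(r / p) ^ n` linearizes the loss and brings in the first
      -- moment.
      have hb := one_add_mul_le_pow (a := r / p - 1) (by linarith) n
      have h := mul_le_mul_of_nonneg_left hb (mul_nonneg (ha n) (pow_nonneg hp0.le n))
      have e : a n * p ^ n * (1 + (r / p - 1)) ^ n = a n * r ^ n := by
        rw [add_sub_cancel, mul_assoc, ← mul_pow, mul_div_cancel₀ _ hp0.ne']
      rw [e] at h
      calc _ = a n * p ^ n * (1 + n * (r / p - 1)) := by ring
        _ ≤ _ := h
    have h := Finset.sum_le_sum hterm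
    rw [Finset.sum_sub_distrib, ← Finset.mul_sum] at h
    have hm := hmean p hp0.le N hFp.le
    have hq1 : 0 ≤ 1 - r / p := by
      rw [sub_nonneg, div_le_one hp0]; exact hp.1
    have hFp' : ∑ n ∈ Finset.range N, a n * p ^ n = 1 := hFp
    rw [hFp'] at h
    calc 1 - (1 + L) * (1 - r / t) ≤ 1 - (1 + L) * (1 - r / p) := by
          have := mul_le_mul_of_nonneg_left hqt (show 0 ≤ 1 + L by linarith)
          linarith
      _ ≤ 1 - (1 - r / p) * ∑ n ∈ Finset.range N, n * (a n * p ^ n) := by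
          have := mul_le_mul_of_nonneg_left hm hq1
          linarith
      _ ≤ _ := h
  refine ⟨r, hrE.1, ?_, fun N => hmean r hr0.le N (hrE.2 N)⟩
  have hnn : ∀ n, 0 ≤ a n * r ^ n := fun n => mul_nonneg (ha n) (pow_nonneg hr0.le n)
  have hs : Summable fun n => a n * r ^ n := summable_of_sum_range_le hnn hrE.2
  have hle : ∑' n, a n * r ^ n ≤ 1 := hs.tsum_le_of_sum_range_le hrE.2
  have hge : 1 ≤ ∑' n, a n * r ^ n := by
    have hev : ∀ᶠ t in nhdsWithin r (Set.Ioi r),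
        1 - (1 + L) * (1 - r / t) ≤ ∑' n, a n * r ^ n := by
      filter_upwards [self_mem_nhdsWithin] with t ht
      obtain ⟨N, hN⟩ := hkey t ht
      exact hN.trans (hs.sum_le_tsum _ fun n _ => hnn n)
    have hlim : Tendsto (fun t => 1 - (1 + L) * (1 - r / t)) (nhdsWithin r (Set.Ioi r))
        (nhds (1 - (1 + L) * (1 - r / r))) := by
      refine Tendsto.mono_left ?_ nhdsWithin_le_nhds
      have : ContinuousAt (fun t => 1 - (1 + L) * (1 - r / t)) r := by
        fun_prop (disch := exact hr0.ne')
      exact this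
    rw [div_self hr0.ne', sub_self, mul_zero, sub_zero] at hlim
    exact le_of_tendsto hlim hev
  have := hs.hasSum
  rwa [le_antisymm hle hge] at this

/-! ### Excursions between regenerations and their law. -/

noncomputable section

namespace MarkedPath

variable {S : Type*}

/-- Up to time `j` the path neither regenerates nor dies. -/
def excursion (j : ℕ) : Set (MarkedPath S) :=
  {ω | (j : ℕ∞) < ω.regenTime ∧ (j : ℕ∞) < ω.deathTime}

lemma mem_excursion_iff (ω : MarkedPath S) (j : ℕ) :
    ω ∈ excursion j ↔ ∀ k ≤ j, ¬ (1 ≤ k ∧ (ω k).2 = true) ∧ ¬ (ω k).1 = Sum.inr () := by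
  rw [excursion, Set.mem_ofPred_eq, lt_regenTime_iff, lt_deathTime_iff]
  exact ⟨fun h k hk => ⟨h.1 k hk, h.2 k hk⟩, fun h => ⟨fun k hk => (h k hk).1, fun k hk => (h k hk).2⟩⟩

lemma mem_excursion_succ_iff (ω : MarkedPath S) (j : ℕ) :
    ω ∈ excursion (j + 1) ↔
      ω ∈ excursion j ∧ (ω (j + 1)).2 = false ∧ ¬ (ω (j + 1)).1 = Sum.inr () := by
  have h1 : 1 ≤ j + 1 := by omega
  simp only [mem_excursion_iff, Nat.le_succ_iff_eq_or_le, or_imp, forall_and, forall_eq, h1,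
    true_and, Bool.not_eq_true]
  tauto

/-- This splits the event into one about the path up to time `k` and one about a single further
transition, the form to which the Markov property applies. -/
lemma regenTime_eq_succ_iff (ω : MarkedPath S) (k : ℕ) :
    (ω.regenTime = (k + 1 : ℕ) ∧ ((k + 1 : ℕ) : ℕ∞) < ω.deathTime) ↔
      ω ∈ excursion k ∧ (ω (k + 1)).2 = true ∧ ¬ (ω (k + 1)).1 = Sum.inr () := by
  have h1 : ω.regenTime = (k + 1 : ℕ) ↔ (k : ℕ∞) < ω.regenTime ∧ (ω (k + 1)).2 = true := by
    have e : ω.regenTime = (k + 1 : ℕ) ↔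
        (k : ℕ∞) < ω.regenTime ∧ ¬ ((k + 1 : ℕ) : ℕ∞) < ω.regenTime := by
      rw [not_lt, ← ENat.add_one_le_iff (ENat.natCast_ne_top k), le_antisymm_iff, and_comm]
      push_cast
      rfl
    rw [e, lt_regenTime_iff, lt_regenTime_iff]
    have h1 : 1 ≤ k + 1 := by omega
    simp only [Nat.le_succ_iff_eq_or_le, or_imp, forall_and, forall_eq, h1, true_and]
    tauto
  have h2 : ((k + 1 : ℕ) : ℕ∞) < ω.deathTime ↔
      (k : ℕ∞) < ω.deathTime ∧ ¬ (ω (k + 1)).1 = Sum.inr () := by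
    rw [lt_deathTime_iff, lt_deathTime_iff]
    simp only [Nat.le_succ_iff_eq_or_le, or_imp, forall_and, forall_eq]
    tauto
  rw [h1, h2, excursion, Set.mem_ofPred_eq]
  tauto

lemma regenTime_ne_zero (ω : MarkedPath S) : ω.regenTime ≠ (0 : ℕ) := by
  have : ((0 : ℕ) : ℕ∞) < ω.regenTime := by
    rw [lt_regenTime_iff]
    intro k hk
    omega
  exact this.ne'

variable [MeasurableSpace S]

lemma measurableSet_excursion (j : ℕ) : MeasurableSet (excursion j : Set (MarkedPath S)) :=
  (measurableSet_lt_regenTime j).inter (measurableSet_lt_deathTime j)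

/-- Being in an excursion at time `j` depends on the path up to time `j` only. -/
lemma exists_excursion_eq_preimage (j : ℕ) :
    ∃ E : Set (Π _ : Finset.Iic j, MarkedState S), MeasurableSet E ∧
      (excursion j : Set (MarkedPath S)) =
        Preorder.frestrictLe (π := fun _ : ℕ => MarkedState S) j ⁻¹' E := by
  -- A finite history is prolonged by its last state; the part after time `j` does not matter.
  refine ⟨(fun h : (Π _ : Finset.Iic j, MarkedState S) =>
    (fun k => if hk : k ≤ j then h ⟨k, Finset.mem_Iic.2 hk⟩ else h ⟨j, Finset.mem_Iic.2 le_rfl⟩ :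
      MarkedPath S)) ⁻¹' excursion j, ?_, ?_⟩
  · refine (measurableSet_excursion j).preimage (measurable_pi_lambda _ fun k => ?_)
    by_cases hk : k ≤ j
    · simp only [hk, dite_true]
      exact measurable_pi_apply _
    · simp only [hk, dite_false]
      exact measurable_pi_apply _
  · ext ω
    simp only [Set.mem_preimage, mem_excursion_iff]
    refine forall_congr' fun k => forall_congr' fun hk => ?_
    simp only [hk, dite_true, Preorder.frestrictLe_apply]

lemma measurableSet_ne_cemetery : MeasurableSet {z : S ⊕ Unit | ¬ z = Sum.inr ()} := by
  convert (measurableSet_range_inl : MeasurableSet (Set.range (Sum.inl : S → S ⊕ Unit))) using 1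
  ext z
  rcases z with z | z <;> simp

lemma measurable_inl_mk (i : Bool) :
    Measurable (fun y : S => ((Sum.inl y, i) : MarkedState S)) :=
  measurable_inl.prodMk measurable_const

lemma isProbabilityMeasure_map_inl (μ : Measure S) [IsProbabilityMeasure μ] :
    IsProbabilityMeasure (μ.map (fun x => ((Sum.inl x, false) : MarkedState S))) :=
  Measure.isProbabilityMeasure_map (measurable_inl.prodMk measurable_const).aemeasurable

end MarkedPath

namespace UniformComparison

open MarkedPath

variable {S : Type*} [MetricSpace S] [MeasurableSpace S] [BorelSpace S]
  {D : DensityKernel S} (A : UniformComparison D)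

lemma pathLaw_map_zero (μ : Measure S) [IsProbabilityMeasure μ] :
    (A.pathLaw μ).map (fun ω => ω 0) = μ.map (fun x => (Sum.inl x, false)) := by
  have := isProbabilityMeasure_map_inl μ
  have h : (fun ω : MarkedPath S => ω 0) =
      (fun h : (Π _ : Finset.Iic 0, MarkedState S) => h ⟨0, Finset.mem_Iic.2 le_rfl⟩) ∘
        Preorder.frestrictLe (π := fun _ : ℕ => MarkedState S) 0 := rfl
  rw [h, ← Measure.map_map (by fun_prop) (by fun_prop), pathLaw, Kernel.trajMeasure,
    Measure.map_comp _ _ (by fun_prop), Kernel.traj_map_frestrictLe, Kernel.partialTraj_self,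
    Measure.id_comp, Measure.map_map (by fun_prop) (by fun_prop)]
  convert Measure.map_id
  funext z
  exact (MeasurableEquiv.piUnique fun _ : Finset.Iic 0 => MarkedState S).apply_symm_apply z

/-- The Markov property of the marked chain at time `n`. -/
lemma pathLaw_inter (μ : Measure S) [IsProbabilityMeasure μ] (n : ℕ)
    {U : Set (MarkedState S)} (hU : MeasurableSet U) :
    A.pathLaw μ (excursion n ∩ {ω | ω (n + 1) ∈ U}) =
      ∫⁻ ω in excursion n, A.stepMeasure (ω n).1 U ∂A.pathLaw μ := by
  have := isProbabilityMeasure_map_inl μ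
  obtain ⟨E, hE, hEe⟩ := exists_excursion_eq_preimage (S := S) n
  have h := congrArg (fun m => m (E ×ˢ U))
    (Kernel.map_frestrictLe_trajMeasure_compProd_eq_map_trajMeasure (X := fun _ => MarkedState S)
      (μ₀ := μ.map (fun x => (Sum.inl x, false)))
      (κ := fun n => A.step.comap (fun h : (Π _ : Finset.Iic n, MarkedState S) =>
        h ⟨n, Finset.mem_Iic.2 le_rfl⟩) (measurable_pi_apply _)) (a := n))
  beta_reduce at h
  rw [Measure.compProd_apply_prod hE hU, Measure.map_apply (by fun_prop) (hE.prod hU),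
    setLIntegral_map hE (Kernel.measurable_coe _ hU) (by fun_prop), ← hEe] at h
  rw [hEe]
  refine Eq.trans ?_ (h.symm.trans ?_)
  · rfl
  · rw [← hEe]; rfl

lemma stepMeasure_inl_apply (x : S) {U : Set (MarkedState S)} (hU : MeasurableSet U) :
    A.stepMeasure (Sum.inl x) U =
      A.delta * A.psi ((fun y => (Sum.inl y, true)) ⁻¹' U) +
        A.residual x ((fun y => (Sum.inl y, false)) ⁻¹' U) +
        (1 - (D.B ^ D.m) x Set.univ) * Measure.dirac (Sum.inr (), false) U := by
  simp only [stepMeasure, Sum.elim_inl, Measure.add_apply, Measure.smul_apply,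
    Measure.map_apply (measurable_inl_mk _) hU, smul_eq_mul]

/-- The law of the chain at time `j` on an excursion that is still running. -/
lemma pathLaw_excursion_map (μ : Measure S) [IsProbabilityMeasure μ] (j : ℕ) :
    ((A.pathLaw μ).restrict (excursion j)).map (fun ω => (ω j).1) =
      (μ.bind ⇑(A.residual ^ j)).map Sum.inl := by
  have hm : ∀ j : ℕ, Measurable fun ω : MarkedPath S => (ω j).1 := fun j => by fun_prop
  induction j with
  | zero =>
    have hE : (excursion 0 : Set (MarkedPath S)) =
        (fun ω => ω 0) ⁻¹' {z | ¬ z.1 = Sum.inr ()} := by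
      ext ω
      simp [mem_excursion_iff]
    have hV : MeasurableSet {z : MarkedState S | ¬ z.1 = Sum.inr ()} :=
      measurableSet_ne_cemetery.preimage measurable_fst
    have hcomp : (fun ω : MarkedPath S => (ω 0).1) = Prod.fst ∘ fun ω => ω 0 := rfl
    have hid : μ.bind ⇑(A.residual ^ 0) = μ := by
      rw [pow_zero]
      exact Measure.bind_dirac
    rw [hE, hcomp, ← Measure.map_map measurable_fst (by fun_prop),
      ← Measure.restrict_map (by fun_prop) hV, pathLaw_map_zero, Measure.restrict_map
      (measurable_inl_mk _) hV, hid]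
    have : (fun x : S => ((Sum.inl x, false) : MarkedState S)) ⁻¹' {z | ¬ z.1 = Sum.inr ()} =
        Set.univ := by
      ext x; simp
    rw [this, Measure.restrict_univ, Measure.map_map measurable_fst (measurable_inl_mk _)]
    rfl
  | succ j ih =>
    ext V hV
    rw [Measure.map_apply (hm _) hV, Measure.restrict_apply (hm _ hV),
      Measure.map_apply measurable_inl hV, pow_succ']
    have hU : MeasurableSet
        {z : MarkedState S | z.1 ∈ V ∧ z.2 = false ∧ ¬ z.1 = Sum.inr ()} :=
      (measurable_fst hV).inter ((measurable_snd (measurableSet_singleton false)).inter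
        (measurableSet_ne_cemetery.preimage measurable_fst))
    have hset : (fun ω : MarkedPath S => (ω (j + 1)).1) ⁻¹' V ∩ excursion (j + 1) =
        excursion j ∩ {ω | ω (j + 1) ∈
          {z : MarkedState S | z.1 ∈ V ∧ z.2 = false ∧ ¬ z.1 = Sum.inr ()}} := by
      ext ω
      simp only [Set.mem_inter_iff, Set.mem_preimage, mem_excursion_succ_iff, Set.mem_ofPred_eq]
      tauto
    have hmeas : Measurable fun z => A.stepMeasure z
        {z : MarkedState S | z.1 ∈ V ∧ z.2 = false ∧ ¬ z.1 = Sum.inr ()} :=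
      (Measure.measurable_coe hU).comp A.measurable_stepMeasure
    rw [hset, A.pathLaw_inter μ j hU, ← lintegral_map hmeas (hm j), ih,
      lintegral_map hmeas measurable_inl]
    have hb : μ.bind ⇑(A.residual * A.residual ^ j) =
        (μ.bind ⇑(A.residual ^ j)).bind ⇑A.residual := by
      rw [Measure.bind_bind (Kernel.aemeasurable _) (Kernel.aemeasurable _)]
      rfl
    rw [hb, Measure.bind_apply (measurable_inl hV) (Kernel.aemeasurable _)]
    -- Of the three parts of a step from `y`, only `B̃` both stays in `S` and leaves the mark
    -- `false`.
    refine lintegral_congr fun y => ?_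
    rw [A.stepMeasure_inl_apply y hU]
    simp [Set.preimage, Measure.dirac_apply' _ hU]

lemma pathLaw_occupation (μ : Measure S) [IsProbabilityMeasure μ] (w : ℕ → ℝ≥0∞) {C : Set S}
    (hC : MeasurableSet C) :
    ∫⁻ ω, occupation w C ω ∂A.pathLaw μ = ∑' j, w j * ∫⁻ x, (A.residual ^ j) x C ∂μ := by
  classical
  have hset : ∀ j : ℕ, MeasurableSet
      (excursion j ∩ (fun ω : MarkedPath S => (ω j).1) ⁻¹' (Sum.inl '' C)) := fun j =>
    (measurableSet_excursion j).inter
      ((measurable_fst.comp (measurable_pi_apply j)) (measurableSet_inl_image.2 hC))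
  have h : occupation w C = fun ω : MarkedPath S => ∑' j,
      (excursion j ∩ (fun ω : MarkedPath S => (ω j).1) ⁻¹' (Sum.inl '' C)).indicator
        (fun _ => w j) ω := by
    ext ω
    refine tsum_congr fun j => ?_
    rw [Set.indicator_apply]
    refine if_congr ?_ rfl rfl
    simp only [excursion, Set.mem_inter_iff, Set.mem_ofPred_eq, Set.mem_preimage]
    tauto
  rw [h, lintegral_tsum fun j => (measurable_const.indicator (hset j)).aemeasurable]
  refine tsum_congr fun j => ?_
  have hm : Measurable fun ω : MarkedPath S => (ω j).1 := by fun_prop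
  rw [lintegral_indicator_const (hset j), Set.inter_comm,
    ← Measure.restrict_apply (hm (measurableSet_inl_image.2 hC)),
    ← Measure.map_apply (by fun_prop) (measurableSet_inl_image.2 hC), pathLaw_excursion_map,
    Measure.map_apply measurable_inl (measurableSet_inl_image.2 hC),
    Set.preimage_image_eq _ Sum.inl_injective, Measure.bind_apply hC (Kernel.aemeasurable _)]

/-- The chance of regenerating at the next step is `δ` from every point of `S`, so only the mass of
the running excursion matters. The term `k = 0` vanishes because `τ ≥ 1`. -/
lemma pathLaw_atRegen (μ : Measure S) [IsProbabilityMeasure μ] (w : ℕ → ℝ≥0∞) :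
    ∫⁻ ω, atRegen w ω ∂A.pathLaw μ =
      ∑' k, w (k + 1) * (A.delta * ∫⁻ x, (A.residual ^ k) x Set.univ ∂μ) := by
  classical
  have hU : MeasurableSet {z : MarkedState S | z.2 = true ∧ ¬ z.1 = Sum.inr ()} :=
    (measurable_snd (measurableSet_singleton true)).inter
      (measurableSet_ne_cemetery.preimage measurable_fst)
  have hset : ∀ k : ℕ, MeasurableSet (excursion k ∩ {ω : MarkedPath S | ω (k + 1) ∈
      {z : MarkedState S | z.2 = true ∧ ¬ z.1 = Sum.inr ()}}) := fun k =>
    (measurableSet_excursion k).inter (measurable_pi_apply (k + 1) hU)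
  have h : atRegen w = fun ω : MarkedPath S => ∑' k,
      (excursion k ∩ {ω : MarkedPath S | ω (k + 1) ∈
        {z : MarkedState S | z.2 = true ∧ ¬ z.1 = Sum.inr ()}}).indicator
        (fun _ => w (k + 1)) ω := by
    ext ω
    rw [atRegen, tsum_eq_zero_add' ENNReal.summable, if_neg fun h => regenTime_ne_zero ω h.1,
      zero_add]
    refine tsum_congr fun k => ?_
    rw [Set.indicator_apply]
    exact if_congr (regenTime_eq_succ_iff ω k) rfl rfl
  rw [h, lintegral_tsum fun k => (measurable_const.indicator (hset k)).aemeasurable]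
  refine tsum_congr fun k => ?_
  have hmeas : Measurable fun z => A.stepMeasure z
      {z : MarkedState S | z.2 = true ∧ ¬ z.1 = Sum.inr ()} :=
    (Measure.measurable_coe hU).comp A.measurable_stepMeasure
  have hm : Measurable fun ω : MarkedPath S => (ω k).1 := by fun_prop
  have hstep : ∀ y : S, A.stepMeasure (Sum.inl y)
      {z : MarkedState S | z.2 = true ∧ ¬ z.1 = Sum.inr ()} = A.delta := by
    intro y
    rw [A.stepMeasure_inl_apply y hU]
    simp [Set.preimage, Measure.dirac_apply' _ hU]
  rw [lintegral_indicator_const (hset k), A.pathLaw_inter μ k hU, ← lintegral_map hmeas hm,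
    pathLaw_excursion_map, lintegral_map hmeas measurable_inl, lintegral_congr hstep,
    lintegral_const, Measure.bind_apply MeasurableSet.univ (Kernel.aemeasurable _)]

end UniformComparison
end

/-! ### Two-sided bounds on `B ^ m` and the defective law of `τ`. -/

noncomputable section

namespace UniformComparison

variable {S : Type*} [MetricSpace S] [MeasurableSpace S] [BorelSpace S]
  {D : DensityKernel S} (A : UniformComparison D)

/-- The ratio `c₂ / c₁` of the comparison constants. -/
def ratio : ℝ := A.c₂ / A.c₁

lemma c₂_pos : 0 < A.c₂ :=
  (div_pos (D.b_pos A.v A.v) (D.b_pos A.v A.v)).trans_le (A.upper A.v A.v)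

lemma ratio_pos : 0 < A.ratio := div_pos A.c₂_pos A.c₁_pos

/-- The upper half of (A4), with `c₂ b(v, ·) ν` rewritten as `(c₂ / c₁) δ ψ` to match the
minorization. -/
lemma pow_le_ratio_smul (x : S) :
    (D.B ^ D.m) x ≤ (ENNReal.ofReal A.ratio * A.delta) • A.psi := by
  have hm : Measurable fun y => ENNReal.ofReal (D.b A.v y) :=
    ENNReal.measurable_ofReal.comp (D.b_meas _)
  rw [mul_smul, delta_smul_psi, D.B_pow, ← withDensity_smul _ hm, ← withDensity_smul _
    (hm.const_smul _)]
  refine withDensity_mono (Filter.Eventually.of_forall fun y => ?_)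
  have h := A.upper x y
  rw [div_le_iff₀ (D.b_pos _ _)] at h
  simp only [Pi.smul_apply, smul_eq_mul]
  rw [← ENNReal.ofReal_mul A.c₁_pos.le, ← ENNReal.ofReal_mul A.ratio_pos.le, ← mul_assoc, ratio,
    div_mul_cancel₀ _ A.c₁_pos.ne']
  exact ENNReal.ofReal_le_ofReal h

lemma residual_le (x : S) : A.residual x ≤ (D.B ^ D.m) x := by
  rw [← A.residual_add x]
  exact Measure.le_add_right le_rfl

lemma residual_le_ratio_smul (x : S) :
    A.residual x ≤ (ENNReal.ofReal A.ratio * A.delta) • A.psi :=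
  (A.residual_le x).trans (A.pow_le_ratio_smul x)

lemma delta_ne_zero : A.delta ≠ 0 :=
  mul_ne_zero (ENNReal.ofReal_pos.2 A.c₁_pos).ne' A.mass_ne_zero

lemma delta_le_one : A.delta ≤ 1 := by
  have h := A.delta_smul_psi_le A.v Set.univ
  rw [Measure.smul_apply, measure_univ, smul_eq_mul, mul_one] at h
  exact h.trans (pow_le_one _ _)

lemma delta_ne_top : A.delta ≠ ⊤ := ne_top_of_le_ne_top ENNReal.one_ne_top A.delta_le_one

lemma lintegral_pow (x : S) (g : S → ℝ≥0∞) :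
    ∫⁻ y, g y ∂(D.B ^ D.m) x = ∫⁻ y, g y ∂A.residual x + A.delta * ∫⁻ y, g y ∂A.psi := by
  rw [← A.residual_add x, lintegral_add_measure, lintegral_smul_measure, smul_eq_mul]

/-- The probability of `τ = k + 1`, `T > τ m` for `X_0` with law `ψ`. -/
def regenLaw (k : ℕ) : ℝ≥0∞ := A.delta * ∫⁻ x, (A.residual ^ k) x Set.univ ∂A.psi

lemma residual_pow_le_one (k : ℕ) (x : S) : (A.residual ^ k) x Set.univ ≤ 1 := by
  induction k generalizing x with
  | zero =>
    rw [pow_zero]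
    change (Kernel.id : Kernel S S) x Set.univ ≤ 1
    simp [Kernel.id_apply]
  | succ n ih =>
    rw [Kernel.pow_succ_apply_eq_lintegral _ _ _ MeasurableSet.univ]
    refine (lintegral_mono fun y => ?_).trans (b := ∫⁻ _, 1 ∂((A.residual ^ n) x)) ?_
    · exact (A.residual_le y _).trans (pow_le_one _ _)
    · simpa using ih x

lemma residual_pow_succ_apply (k : ℕ) (x : S) :
    (A.residual ^ (k + 1)) x Set.univ = ∫⁻ y, (A.residual ^ k) y Set.univ ∂A.residual x := by
  rw [add_comm, Kernel.pow_add_apply_eq_lintegral _ _ _ _ MeasurableSet.univ, pow_one]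

lemma lintegral_residual_pow (j k : ℕ) :
    ∫⁻ x, (A.residual ^ (j + k)) x Set.univ ∂A.psi =
      ∫⁻ x, ∫⁻ y, (A.residual ^ k) y Set.univ ∂(A.residual ^ j) x ∂A.psi :=
  lintegral_congr fun _ => Kernel.pow_add_apply_eq_lintegral _ _ _ _ MeasurableSet.univ

lemma regenLaw_zero : A.regenLaw 0 = A.delta := by
  have : ∀ x : S, (A.residual ^ 0) x Set.univ = 1 := by
    intro x
    rw [pow_zero]
    change (Kernel.id : Kernel S S) x Set.univ = 1
    simp [Kernel.id_apply]
  rw [regenLaw, lintegral_congr this]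
  simp

lemma regenLaw_le_one (k : ℕ) : A.regenLaw k ≤ 1 := by
  refine mul_le_one' A.delta_le_one ?_
  calc _ ≤ ∫⁻ _, 1 ∂A.psi := lintegral_mono fun x => A.residual_pow_le_one k x
    _ = 1 := by simp

/-- After `j` steps of the excursion, the next step is dominated by `ratio * δ` times a fresh start
from `ψ`. As `regenLaw j` refers to `τ = j + 1`, the index `j + k + 1` corresponds to adding the two
values of `τ`. -/
lemma regenLaw_submultiplicative (j k : ℕ) :
    A.regenLaw (j + k + 1) ≤ ENNReal.ofReal A.ratio * (A.regenLaw j * A.regenLaw k) := by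
  rw [regenLaw, add_assoc, lintegral_residual_pow]
  have h : ∀ y : S, (A.residual ^ (k + 1)) y Set.univ ≤ ENNReal.ofReal A.ratio * A.regenLaw k := by
    intro y
    rw [residual_pow_succ_apply]
    refine (lintegral_mono' (A.residual_le_ratio_smul y) le_rfl).trans_eq ?_
    rw [lintegral_smul_measure, smul_eq_mul, regenLaw, mul_assoc]
  calc _ ≤ A.delta * ∫⁻ x, ∫⁻ _, ENNReal.ofReal A.ratio * A.regenLaw k
        ∂(A.residual ^ j) x ∂A.psi := by
        gcongr with x y
        exact h y
    _ = _ := by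
        simp_rw [lintegral_const]
        rw [lintegral_const_mul' _ _
          (ENNReal.mul_ne_top ENNReal.ofReal_ne_top (ne_top_of_le_ne_top ENNReal.one_ne_top
            (A.regenLaw_le_one k)))]
        simp only [regenLaw]
        ring

/-- With weight `1` the sum is the expectation of a sum of indicators of disjoint events. -/
lemma tsum_regenLaw_le_one : ∑' k, A.regenLaw k ≤ 1 := by
  have hp : IsProbabilityMeasure (A.pathLaw A.psi) := by
    have := MarkedPath.isProbabilityMeasure_map_inl A.psi
    unfold pathLaw
    infer_instance
  have h := A.pathLaw_atRegen A.psi (fun _ => 1)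
  simp only [one_mul] at h
  simp only [regenLaw]
  rw [← h]
  calc _ ≤ ∫⁻ _, 1 ∂A.pathLaw A.psi := by
        refine lintegral_mono fun ω => ?_
        classical
        by_cases ht : ∃ k : ℕ, ω.regenTime = k
        · obtain ⟨k, hk⟩ := ht
          rw [MarkedPath.atRegen, tsum_eq_single k]
          · split_ifs <;> simp
          · intro j hj
            rw [if_neg]
            rintro ⟨h, -⟩
            rw [hk] at h
            exact hj (by exact_mod_cast h.symm)
        · push Not at ht
          simp [MarkedPath.atRegen, ht]
    _ = 1 := by simp

lemma regenTransform_eq (θ : ℝ) : A.regenTransform θ =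
    ∑' k : ℕ, ENNReal.ofReal (Real.exp (θ * (k + 1 : ℕ))) * A.regenLaw k :=
  A.pathLaw_atRegen A.psi _

lemma regenMean_eq (θ : ℝ) : A.regenMean θ =
    ∑' k : ℕ, ((k + 1 : ℕ) : ℝ≥0∞) * ENNReal.ofReal (Real.exp (θ * (k + 1 : ℕ))) *
      A.regenLaw k :=
  A.pathLaw_atRegen A.psi _

lemma uStar_eq (θ : ℝ) (x : S) : A.uStar θ x =
    ∑' k : ℕ, ENNReal.ofReal (Real.exp (θ * (k + 1 : ℕ))) *
      (A.delta * (A.residual ^ k) x Set.univ) := by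
  rw [uStar, pathLaw_atRegen]
  refine tsum_congr fun k => ?_
  rw [lintegral_dirac' _ (Kernel.measurable_coe _ MeasurableSet.univ)]

lemma etaStar_apply (θ : ℝ) {C : Set S} (hC : MeasurableSet C) : A.etaStar θ C =
    ∑' j : ℕ, ENNReal.ofReal (Real.exp (θ * j)) * ∫⁻ x, (A.residual ^ j) x C ∂A.psi := by
  rw [etaStar, Measure.ofMeasurable_apply _ hC, pathLaw_occupation _ _ _ hC]

/-- The equation `E_ψ e^{θ τ} I(T > τ m) = 1` has a solution `θ ≥ 0`. -/
lemma exists_regenTransform_eq_one : ∃ θ : ℝ, 0 ≤ θ ∧ A.regenTransform θ = 1 ∧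
    A.regenMean θ < ∞ := by
  -- The shift makes `a n` the probability of `τ = n`, `T > n m`; then `θ = log s`, nonnegative
  -- since `s ≥ 1`.
  set a : ℕ → ℝ := fun n => if n = 0 then 0 else (A.regenLaw (n - 1)).toReal with ha
  have hfin : ∀ k, A.regenLaw k ≠ ⊤ := fun k =>
    ne_top_of_le_ne_top ENNReal.one_ne_top (A.regenLaw_le_one k)
  have ha0 : a 0 = 0 := by simp [ha]
  have has : ∀ k, a (k + 1) = (A.regenLaw k).toReal := fun k => by simp [ha]
  have hofs : ∀ k, ENNReal.ofReal (a (k + 1)) = A.regenLaw k := fun k => by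
    rw [has, ENNReal.ofReal_toReal (hfin k)]
  have hnn : ∀ n, 0 ≤ a n := by
    rintro (_ | n)
    · exact ha0.ge
    · rw [has]; exact ENNReal.toReal_nonneg
  have ha1 : 0 < a 1 := by
    rw [has, regenLaw_zero]
    exact ENNReal.toReal_pos A.delta_ne_zero A.delta_ne_top
  have hsub1 : ∀ N, ∑ n ∈ Finset.range N, a n ≤ 1 := by
    intro N
    rcases N with _ | N
    · simp
    · rw [Finset.sum_range_succ', ha0, add_zero, Finset.sum_congr rfl fun k _ => has k,
        ← ENNReal.toReal_sum fun k _ => hfin k]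
      exact ENNReal.toReal_le_of_le_ofReal zero_le_one
        ((ENNReal.sum_le_tsum _).trans (by simpa using A.tsum_regenLaw_le_one))
  have hsub : ∀ i j, 1 ≤ i → 1 ≤ j → a (i + j) ≤ A.ratio * (a i * a j) := by
    rintro (_ | i) (_ | j) hi hj
    · omega
    · omega
    · omega
    · rw [show i + 1 + (j + 1) = (i + j + 1) + 1 by omega, has, has, has]
      have h := ENNReal.toReal_mono (ENNReal.mul_ne_top ENNReal.ofReal_ne_top
        (ENNReal.mul_ne_top (hfin i) (hfin j))) (A.regenLaw_submultiplicative i j)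
      rwa [ENNReal.toReal_mul, ENNReal.toReal_mul, ENNReal.toReal_ofReal A.ratio_pos.le] at h
  obtain ⟨s, hs, hsum, hmean⟩ := exists_hasSum_mul_pow_eq_one A.ratio_pos.le hnn ha1 hsub1 hsub
  have hs0 : 0 < s := one_pos.trans_le hs
  have hexp : ∀ n : ℕ, Real.exp (Real.log s * n) = s ^ n := by
    intro n
    rw [mul_comm, Real.exp_nat_mul, Real.exp_log hs0]
  refine ⟨Real.log s, Real.log_nonneg hs, ?_, ?_⟩
  · rw [regenTransform_eq]
    have h := ENNReal.ofReal_tsum_of_nonneg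
      (fun n => mul_nonneg (hnn n) (pow_nonneg hs0.le n)) hsum.summable
    rw [hsum.tsum_eq, ENNReal.ofReal_one, tsum_eq_zero_add' ENNReal.summable, ha0, zero_mul,
      ENNReal.ofReal_zero, zero_add] at h
    rw [h]
    refine tsum_congr fun k => ?_
    rw [hexp, ENNReal.ofReal_mul (hnn _), hofs, mul_comm]
  · rw [regenMean_eq]
    refine lt_of_le_of_lt (b := ENNReal.ofReal (1 + A.ratio)) ?_ ENNReal.ofReal_lt_top
    rw [ENNReal.tsum_eq_iSup_nat]
    refine iSup_le fun N => ?_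
    have h := hmean (N + 1)
    rw [Finset.sum_range_succ', Nat.cast_zero, zero_mul, add_zero] at h
    refine le_trans (le_of_eq ?_) (ENNReal.ofReal_le_ofReal h)
    rw [ENNReal.ofReal_sum_of_nonneg fun n _ => mul_nonneg (Nat.cast_nonneg _)
      (mul_nonneg (hnn _) (pow_nonneg hs0.le _))]
    refine Finset.sum_congr rfl fun k _ => ?_
    rw [hexp, ENNReal.ofReal_mul (Nat.cast_nonneg _), ENNReal.ofReal_mul (hnn _), hofs,
      ENNReal.ofReal_natCast]
    ring

end UniformComparison
end

/-! ### The eigenfunction `u_*` and the eigenmeasure `η_*` of `B ^ m`. -/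

noncomputable section

namespace UniformComparison

variable {S : Type*} [MetricSpace S] [MeasurableSpace S] [BorelSpace S]
  {D : DensityKernel S} (A : UniformComparison D)

lemma measurable_uStar (θ : ℝ) : Measurable (A.uStar θ) := by
  have : A.uStar θ = fun x => ∑' k : ℕ, ENNReal.ofReal (Real.exp (θ * (k + 1 : ℕ))) *
      (A.delta * (A.residual ^ k) x Set.univ) := funext fun x => A.uStar_eq θ x
  rw [this]
  exact Measurable.tsum fun k =>
    ((Kernel.measurable_coe _ MeasurableSet.univ).const_mul _).const_mul _

lemma lintegral_uStar_psi (θ : ℝ) : ∫⁻ x, A.uStar θ x ∂A.psi = A.regenTransform θ := by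
  rw [regenTransform_eq]
  simp_rw [uStar_eq]
  rw [lintegral_tsum fun k =>
    (((Kernel.measurable_coe _ MeasurableSet.univ).const_mul _).const_mul _).aemeasurable]
  refine tsum_congr fun k => ?_
  rw [lintegral_const_mul' _ _ ENNReal.ofReal_ne_top, lintegral_const_mul' _ _ A.delta_ne_top,
    regenLaw]

lemma ofReal_exp_mul_succ (θ : ℝ) (k : ℕ) :
    ENNReal.ofReal (Real.exp (θ * ((k + 1 : ℕ) : ℝ))) =
      ENNReal.ofReal (Real.exp θ) * ENNReal.ofReal (Real.exp (θ * k)) := by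
  rw [← ENNReal.ofReal_mul (Real.exp_nonneg _), ← Real.exp_add]
  push_cast
  ring_nf

/-- First-step decomposition: either the chain regenerates at once, or it makes a `B̃` step and the
excursion continues. -/
lemma uStar_eq_add_lintegral_residual (θ : ℝ) (x : S) : A.uStar θ x =
    ENNReal.ofReal (Real.exp θ) * (A.delta + ∫⁻ y, A.uStar θ y ∂A.residual x) := by
  have h0 : (A.residual ^ 0) x Set.univ = 1 := by
    rw [pow_zero]
    change (Kernel.id : Kernel S S) x Set.univ = 1
    simp [Kernel.id_apply]
  have hint : ∫⁻ y, A.uStar θ y ∂A.residual x = ∑' k : ℕ,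
      ENNReal.ofReal (Real.exp (θ * (k + 1 : ℕ))) *
        (A.delta * (A.residual ^ (k + 1)) x Set.univ) := by
    simp_rw [uStar_eq]
    rw [lintegral_tsum fun k =>
      (((Kernel.measurable_coe _ MeasurableSet.univ).const_mul _).const_mul _).aemeasurable]
    refine tsum_congr fun k => ?_
    rw [lintegral_const_mul' _ _ ENNReal.ofReal_ne_top, lintegral_const_mul' _ _ A.delta_ne_top,
      residual_pow_succ_apply]
  rw [hint, uStar_eq, tsum_eq_zero_add' ENNReal.summable, h0, mul_add, ← ENNReal.tsum_mul_left]
  congr 1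
  · simp
  · refine tsum_congr fun k => ?_
    rw [ofReal_exp_mul_succ, mul_assoc]

/-- As `∫ u_* dψ = 1`, the regeneration term `δ` equals `δ ∫ u_* dψ`, exactly what is missing
between `B̃` and `B ^ m`. -/
lemma uStar_eq_lintegral_pow {θ : ℝ} (hθ : A.regenTransform θ = 1) (x : S) : A.uStar θ x =
    ENNReal.ofReal (Real.exp θ) * ∫⁻ y, A.uStar θ y ∂(D.B ^ D.m) x := by
  rw [lintegral_pow, lintegral_uStar_psi, hθ, mul_one, add_comm,
    ← uStar_eq_add_lintegral_residual]

lemma le_uStar (θ : ℝ) (x : S) : ENNReal.ofReal (Real.exp θ) * A.delta ≤ A.uStar θ x := by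
  rw [uStar_eq_add_lintegral_residual]
  gcongr
  exact le_self_add

lemma uStar_le {θ : ℝ} (hθ : A.regenTransform θ = 1) (x : S) : A.uStar θ x ≤
    ENNReal.ofReal (Real.exp θ) * (ENNReal.ofReal A.ratio * A.delta) := by
  rw [uStar_eq_lintegral_pow _ hθ]
  gcongr
  refine (lintegral_mono' (A.pow_le_ratio_smul x) le_rfl).trans_eq ?_
  rw [lintegral_smul_measure, lintegral_uStar_psi, hθ, smul_eq_mul, mul_one]

lemma etaStar_eq_sum (θ : ℝ) : A.etaStar θ = Measure.sum fun j : ℕ =>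
    ENNReal.ofReal (Real.exp (θ * j)) • A.psi.bind ⇑(A.residual ^ j) := by
  ext C hC
  rw [etaStar_apply _ _ hC, Measure.sum_apply _ hC]
  refine tsum_congr fun j => ?_
  rw [Measure.smul_apply, Measure.bind_apply hC (Kernel.aemeasurable _), smul_eq_mul]

/-- Each unit of occupation at time `j` regenerates at time `j + 1` with probability `δ`. When the
transform is `1` this makes `η_*` finite. -/
lemma mul_etaStar_univ (θ : ℝ) :
    ENNReal.ofReal (Real.exp θ) * A.delta * A.etaStar θ Set.univ = A.regenTransform θ := by
  rw [regenTransform_eq, etaStar_apply _ _ MeasurableSet.univ, ← ENNReal.tsum_mul_left]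
  refine tsum_congr fun k => ?_
  rw [ofReal_exp_mul_succ, regenLaw]
  ring

/-- The term `j = 0` is `ψ`; each later term is the previous one moved by a further `B̃` step. -/
lemma etaStar_eq_psi_add (θ : ℝ) : A.etaStar θ =
    A.psi + ENNReal.ofReal (Real.exp θ) • (A.etaStar θ).bind ⇑A.residual := by
  ext C hC
  rw [Measure.add_apply, Measure.smul_apply, Measure.bind_apply hC (Kernel.aemeasurable _),
    smul_eq_mul, etaStar_apply _ _ hC, tsum_eq_zero_add' ENNReal.summable]
  congr 1
  · have h0 : ∀ x, (A.residual ^ 0) x C = C.indicator 1 x := by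
      intro x
      rw [pow_zero]
      change (Kernel.id : Kernel S S) x C = _
      rw [Kernel.id_apply, Measure.dirac_apply' _ hC]
    rw [lintegral_congr h0, lintegral_indicator_one hC]
    simp
  · rw [etaStar_eq_sum, lintegral_sum_measure, ← ENNReal.tsum_mul_left]
    refine tsum_congr fun k => ?_
    rw [lintegral_smul_measure, Measure.lintegral_bind (Kernel.aemeasurable _)
      (Kernel.measurable_coe _ hC).aemeasurable, ofReal_exp_mul_succ, smul_eq_mul, mul_assoc]
    congr 2
    exact lintegral_congr fun x => Kernel.pow_succ_apply_eq_lintegral _ _ _ hC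

/-- `η_*` is a left eigenmeasure of `B ^ m`. -/
lemma smul_etaStar_bind {θ : ℝ} (hθ : A.regenTransform θ = 1) :
    ENNReal.ofReal (Real.exp θ) • (A.etaStar θ).bind ⇑(D.B ^ D.m) = A.etaStar θ := by
  ext C hC
  have h := congrArg (fun μ : Measure S => μ C) (A.etaStar_eq_psi_add θ)
  simp only [Measure.add_apply, Measure.smul_apply, Measure.bind_apply hC (Kernel.aemeasurable _),
    smul_eq_mul] at h
  rw [h, Measure.smul_apply, Measure.bind_apply hC (Kernel.aemeasurable _), smul_eq_mul]
  have hx : ∀ x, (D.B ^ D.m) x C = A.residual x C + A.delta * A.psi C := by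
    intro x
    rw [← A.residual_add x, Measure.add_apply, Measure.smul_apply, smul_eq_mul]
  -- Replacing `B̃` by `B ^ m` adds `e^θ δ η_*(S) ψ`, which is exactly `ψ` by `mul_etaStar_univ`.
  rw [lintegral_congr hx, lintegral_add_right _ measurable_const, lintegral_const, mul_add,
    add_comm]
  congr 1
  rw [mul_comm, mul_comm A.delta, mul_assoc, mul_assoc, mul_comm _ (ENNReal.ofReal _), ← mul_assoc,
    ← mul_assoc]
  have e := A.mul_etaStar_univ θ
  rw [hθ] at e
  calc _ = A.psi C * (ENNReal.ofReal (Real.exp θ) * A.delta * A.etaStar θ Set.univ) := by ring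
    _ = _ := by rw [e, mul_one]

end UniformComparison

/-! ### Oscillation contraction for a minorized kernel. -/

section Contraction

variable {α : Type*} [MeasurableSpace α] {P : Kernel α α} {ψ η : Measure α} {h f : α → ℝ}
  {s δ H m : ℝ}

lemma integrable_of_abs_le [IsFiniteMeasure η] {b : ℝ} (hf : Measurable f)
    (hb : ∀ x, |f x| ≤ b) : Integrable f η :=
  Integrable.of_bound hf.aestronglyMeasurable b (Eventually.of_forall hb)

/-- One step of the oscillation contraction, relative to the eigenfunction `h`. -/
lemma le_kernel_step [IsFiniteKernel P] [IsFiniteMeasure ψ] (hs : 0 < s) (hδ : 0 < δ)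
    (hH : 0 < H) (hmin : ∀ x, ENNReal.ofReal δ • ψ ≤ P x) (hm : Measurable h)
    (hpos : ∀ x, 0 ≤ h x) (hle : ∀ x, h x ≤ H) (heig : ∀ x, s * ∫ y, h y ∂P x = h x)
    (hψ : ∫ y, h y ∂ψ = 1) {b : ℝ} (hf : Measurable f) (hb : ∀ x, |f x| ≤ b)
    (hfm : ∀ x, m * h x ≤ f x) (x : α) :
    (m + s * δ / H * (∫ y, f y ∂ψ - m)) * h x ≤ s * ∫ y, f y ∂P x := by
  have hhb : ∀ x, |h x| ≤ H := fun x => by rw [abs_of_nonneg (hpos x)]; exact hle x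
  have ih : ∀ μ : Measure α, IsFiniteMeasure μ → Integrable (fun y => m * h y) μ := fun μ _ =>
    (integrable_of_abs_le hm hhb).const_mul m
  have jf : ∀ μ : Measure α, IsFiniteMeasure μ → Integrable f μ := fun μ _ =>
    integrable_of_abs_le hf hb
  have hg : ∀ μ : Measure α, IsFiniteMeasure μ →
      ∫ y, (f y - m * h y) ∂μ = ∫ y, f y ∂μ - m * ∫ y, h y ∂μ := fun μ hμ => by
    rw [integral_sub (jf μ hμ) (ih μ hμ), integral_const_mul]
  have hnn : ∀ y, 0 ≤ f y - m * h y := fun y => sub_nonneg.2 (hfm y)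
  have h1 : δ * ∫ y, (f y - m * h y) ∂ψ ≤ ∫ y, (f y - m * h y) ∂P x := by
    have := integral_mono_measure (hmin x) (Eventually.of_forall hnn)
      ((jf (P x) inferInstance).sub (ih (P x) inferInstance))
    rwa [integral_smul_measure, ENNReal.toReal_ofReal hδ.le, smul_eq_mul] at this
  have h0 : 0 ≤ ∫ y, (f y - m * h y) ∂ψ := integral_nonneg hnn
  rw [hg ψ inferInstance, hψ, mul_one] at h0 h1
  rw [hg (P x) inferInstance] at h1
  have h2 := mul_le_mul_of_nonneg_left h1 hs.le
  have e : s * (∫ y, f y ∂P x - m * ∫ y, h y ∂P x) = s * ∫ y, f y ∂P x - m * h x := by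
    rw [← heig x]
    ring
  rw [e] at h2
  -- The gain from the minorization is a constant; `h ≤ H` turns it into a multiple of `h`.
  have h3 : s * δ / H * (∫ y, f y ∂ψ - m) * h x ≤ s * (δ * (∫ y, f y ∂ψ - m)) := by
    calc _ = s * (δ * (∫ y, f y ∂ψ - m)) * (h x / H) := by ring
      _ ≤ s * (δ * (∫ y, f y ∂ψ - m)) * 1 := by
        refine mul_le_mul_of_nonneg_left ((div_le_one hH).2 (hle x)) ?_
        positivity
      _ = _ := mul_one _
  rw [add_mul]
  linarith

/-- A Perron–Frobenius theorem for a kernel with a uniform minorization, an eigenfunction `h`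
bounded away from `0` and `∞`, and a finite left eigenmeasure `η`. -/
theorem exists_forall_abs_pow_integral_sub_le [IsFiniteMeasure ψ]
    [IsFiniteMeasure η] (hP : ∀ x, P x Set.univ ≤ 1) (hs : 0 < s) (hδ : 0 < δ)
    (hη0 : 0 < ∫ y, h y ∂η)
    (hmin : ∀ x, ENNReal.ofReal δ • ψ ≤ P x) (hm : Measurable h) (hge : ∀ x, s * δ ≤ h x)
    (hle : ∀ x, h x ≤ H) (hH : s * δ ≤ H) (heig : ∀ x, s * ∫ y, h y ∂P x = h x)
    (hψ : ∫ y, h y ∂ψ = 1) (hη : ENNReal.ofReal s • η.bind ⇑P = η)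
    {b : ℝ} (hf : Measurable f) (hb : ∀ x, |f x| ≤ b) :
    ∃ C : ℝ, ∀ (k : ℕ) (x : α),
      |s ^ k * ∫ y, f y ∂(P ^ k) x - (∫ y, f y ∂η) / (∫ y, h y ∂η) * h x| ≤
        C * (1 - s * δ / H) ^ k := by
  have hsδ : 0 < s * δ := mul_pos hs hδ
  have hH0 : 0 < H := hsδ.trans_le hH
  have hPf : IsFiniteKernel P := ⟨⟨1, ENNReal.one_lt_top, hP⟩⟩
  have hpos : ∀ x, 0 ≤ h x := fun x => hsδ.le.trans (hge x)
  have hhb : ∀ x, |h x| ≤ H := fun x => by rw [abs_of_nonneg (hpos x)]; exact hle x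
  have hPk : ∀ k, IsFiniteKernel (P ^ k) := by
    intro k
    induction k with
    | zero => rw [pow_zero]; exact inferInstanceAs (IsFiniteKernel Kernel.id)
    | succ k ih => rw [pow_succ]; exact inferInstanceAs (IsFiniteKernel ((P ^ k) ∘ₖ P))
  set F : ℕ → α → ℝ := fun k x => s ^ k * ∫ y, f y ∂(P ^ k) x with hF
  have hFm : ∀ k, Measurable (F k) := fun k =>
    (hf.stronglyMeasurable.integral_kernel (κ := P ^ k)).measurable.const_mul _
  have hF0 : F 0 = f := by
    ext x
    simp only [hF, pow_zero, one_mul]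
    change ∫ y, f y ∂(Kernel.id : Kernel α α) x = f x
    rw [Kernel.id_apply, integral_dirac' _ _ hf.stronglyMeasurable]
  have hFs : ∀ k x, F (k + 1) x = s * ∫ y, F k y ∂P x := by
    intro k x
    simp only [hF]
    rw [pow_succ P, integral_const_mul, pow_succ s]
    have : ∫ y, f y ∂(P ^ k * P) x = ∫ z, ∫ y, f y ∂(P ^ k) z ∂P x :=
      Kernel.integral_comp (integrable_of_abs_le (η := ((P ^ k) ∘ₖ P) x) hf hb)
    rw [this]
    ring
  -- `F k / h` lies in `[m, M]`. Initially `h ≥ s δ` gives `|f| / h ≤ |b| / (s δ)`.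
  have hbound : ∀ k, ∃ m M : ℝ, M - m = (1 - s * δ / H) ^ k * (2 * (|b| / (s * δ))) ∧
      ∀ x, m * h x ≤ F k x ∧ F k x ≤ M * h x := by
    intro k
    induction k with
    | zero =>
      refine ⟨-(|b| / (s * δ)), |b| / (s * δ), by ring, fun x => ?_⟩
      have h1 : |f x| ≤ |b| / (s * δ) * h x := by
        calc |f x| ≤ |b| := (hb x).trans (le_abs_self b)
          _ = |b| / (s * δ) * (s * δ) := (div_mul_cancel₀ _ hsδ.ne').symm
          _ ≤ _ := by gcongr; exact hge x
      rw [hF0, neg_mul]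
      exact abs_le.1 h1
    | succ k ih =>
      obtain ⟨m, M, hMm, hx⟩ := ih
      have hFb : ∀ x, |F k x| ≤ max |m| |M| * H := by
        intro x
        have h1 : |m * h x| ≤ max |m| |M| * H := by
          rw [abs_mul]
          exact mul_le_mul (le_max_left _ _) (hhb x) (abs_nonneg _)
            ((abs_nonneg m).trans (le_max_left _ _))
        have h2 : |M * h x| ≤ max |m| |M| * H := by
          rw [abs_mul]
          exact mul_le_mul (le_max_right _ _) (hhb x) (abs_nonneg _)
            ((abs_nonneg m).trans (le_max_left _ _))
        exact abs_le.2 ⟨(abs_le.1 h1).1.trans (hx x).1, (hx x).2.trans (abs_le.1 h2).2⟩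
      -- Both ends move towards `∫ F k dψ` by the same proportion, so this value cancels from the
      -- new width. The upper end is the lower one for `-F k`.
      refine ⟨m + s * δ / H * (∫ y, F k y ∂ψ - m), M - s * δ / H * (M - ∫ y, F k y ∂ψ), ?_,
        fun x => ⟨?_, ?_⟩⟩
      · rw [pow_succ, mul_right_comm, ← hMm]
        ring
      · rw [hFs]
        exact le_kernel_step hs hδ hH0 hmin hm hpos hle heig hψ (hFm k) hFb
          (fun x => (hx x).1) x
      · have := le_kernel_step (f := fun x => -F k x) (m := -M) hs hδ hH0 hmin hm hpos hle
          heig hψ (hFm k).neg (b := max |m| |M| * H) (fun x => by rw [abs_neg]; exact hFb x)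
          (fun x => by rw [neg_mul, neg_le_neg_iff]; exact (hx x).2) x
        rw [integral_neg, integral_neg] at this
        rw [hFs]
        linarith
  have hFint : ∀ k, Integrable (F k) η := by
    intro k
    obtain ⟨m, M, -, hx⟩ := hbound k
    refine Integrable.mono' (g := fun x => (|m| + |M|) * h x)
      ((integrable_of_abs_le hm hhb).const_mul _) (hFm k).aestronglyMeasurable
      (Eventually.of_forall fun x => ?_)
    rw [Real.norm_eq_abs, abs_le]
    have h1 := hpos x
    have h2 := mul_le_mul_of_nonneg_right (neg_abs_le m) h1
    have h3 := mul_le_mul_of_nonneg_right (le_abs_self M) h1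
    have h4 := mul_nonneg (abs_nonneg m) h1
    have h5 := mul_nonneg (abs_nonneg M) h1
    constructor
    · linarith [(hx x).1]
    · linarith [(hx x).2]
  -- Conservation of the `η`-integral places `∫ f dη / ∫ h dη` in every interval `[m, M]`, so it is
  -- the limit.
  have hinv : ∀ k, ∫ x, F k x ∂η = ∫ x, f x ∂η := by
    intro k
    induction k with
    | zero => rw [hF0]
    | succ k ih =>
      rw [← ih]
      conv_rhs => rw [← hη, integral_smul_measure, ENNReal.toReal_ofReal hs.le, smul_eq_mul]
      simp_rw [hFs]
      rw [integral_const_mul]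
      congr 1
      have hi := hFint k
      rw [← hη, integrable_smul_measure (ENNReal.ofReal_pos.2 hs).ne' ENNReal.ofReal_ne_top] at hi
      exact (Kernel.integral_comp (κ := Kernel.const Unit η) (η := P) (a := ()) hi).symm
  refine ⟨2 * (|b| / (s * δ)) * H, fun k x => ?_⟩
  obtain ⟨m, M, hMm, hx⟩ := hbound k
  have hhint : Integrable h η := integrable_of_abs_le hm hhb
  have hc1 : m ≤ (∫ y, f y ∂η) / ∫ y, h y ∂η := by
    rw [le_div_iff₀ hη0, ← hinv k, ← integral_const_mul]
    exact integral_mono (hhint.const_mul _) (hFint k) fun x => (hx x).1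
  have hc2 : (∫ y, f y ∂η) / ∫ y, h y ∂η ≤ M := by
    rw [div_le_iff₀ hη0, ← hinv k, ← integral_const_mul]
    exact integral_mono (hFint k) (hhint.const_mul _) fun x => (hx x).2
  set c := (∫ y, f y ∂η) / ∫ y, h y ∂η
  change |F k x - c * h x| ≤ _
  have h1 := mul_le_mul_of_nonneg_right hc1 (hpos x)
  have h2 := mul_le_mul_of_nonneg_right hc2 (hpos x)
  have h3 : |F k x - c * h x| ≤ (M - m) * h x := by
    rw [abs_le]
    constructor <;> linarith [(hx x).1, (hx x).2]
  calc _ ≤ (M - m) * h x := h3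
    _ ≤ (M - m) * H := mul_le_mul_of_nonneg_left (hle x) (sub_nonneg.2 (hc1.trans hc2))
    _ = _ := by rw [hMm]; ring

end Contraction
end

/-! ### Convergence for `B ^ m` and passage to all powers of `B`. -/

noncomputable section

lemma kernel_pow_integral_eq_of_eigen {α : Type*} [MeasurableSpace α] {P : Kernel α α}
    (hP : ∀ (k : ℕ) x, (P ^ k) x Set.univ ≤ 1) {g : α → ℝ} {s b : ℝ} (hg : Measurable g)
    (hb : ∀ x, |g x| ≤ b) (heig : ∀ x, ∫ y, g y ∂P x = s * g x) (k : ℕ) (x : α) :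
    ∫ y, g y ∂(P ^ k) x = s ^ k * g x := by
  induction k with
  | zero =>
    rw [pow_zero, pow_zero, one_mul]
    change ∫ y, g y ∂(Kernel.id : Kernel α α) x = g x
    rw [Kernel.id_apply, integral_dirac' _ _ hg.stronglyMeasurable]
  | succ k ih =>
    have : IsFiniteMeasure ((P ^ (k + 1)) x) := ⟨(hP _ x).trans_lt ENNReal.one_lt_top⟩
    have e : ∫ y, g y ∂(P ^ (k + 1)) x = ∫ z, ∫ y, g y ∂P z ∂(P ^ k) x := by
      have hi : Integrable g ((P ^ (k + 1)) x) := integrable_of_abs_le hg hb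
      rw [pow_succ'] at hi ⊢
      exact Kernel.integral_comp hi
    rw [e]
    simp_rw [heig]
    rw [integral_const_mul, ih, pow_succ]
    ring

namespace UniformComparison

variable {S : Type*} [MetricSpace S] [MeasurableSpace S] [BorelSpace S]
  {D : DensityKernel S} (A : UniformComparison D) {θ : ℝ}

lemma pow_pow_le_one (D : DensityKernel S) (k : ℕ) (x : S) :
    ((D.B ^ D.m) ^ k) x Set.univ ≤ 1 := by
  rw [← pow_mul]
  exact pow_le_one _ _

lemma isFiniteMeasure_pow (D : DensityKernel S) (n : ℕ) (x : S) :
    IsFiniteMeasure ((D.B ^ n) x) := ⟨(pow_le_one n x).trans_lt ENNReal.one_lt_top⟩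

lemma uStar_bound_ne_top :
    ENNReal.ofReal (Real.exp θ) * (ENNReal.ofReal A.ratio * A.delta) ≠ ∞ :=
  ENNReal.mul_ne_top ENNReal.ofReal_ne_top
    (ENNReal.mul_ne_top ENNReal.ofReal_ne_top A.delta_ne_top)

lemma uStar_ne_top (hθ : A.regenTransform θ = 1) (x : S) : A.uStar θ x ≠ ∞ :=
  ne_top_of_le_ne_top A.uStar_bound_ne_top (A.uStar_le hθ x)

lemma uStar_pos (θ : ℝ) (x : S) : 0 < A.uStar θ x :=
  lt_of_lt_of_le (ENNReal.mul_pos (ENNReal.ofReal_pos.2 (Real.exp_pos θ)).ne' A.delta_ne_zero)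
    (A.le_uStar θ x)

lemma etaStar_univ_lt_top (hθ : A.regenTransform θ = 1) : A.etaStar θ Set.univ < ∞ := by
  have h := A.mul_etaStar_univ θ
  rw [hθ] at h
  refine lt_top_iff_ne_top.2 fun htop => ?_
  rw [htop, ENNReal.mul_top (mul_ne_zero (ENNReal.ofReal_pos.2 (Real.exp_pos θ)).ne'
    A.delta_ne_zero)] at h
  exact ENNReal.top_ne_one h

lemma one_le_lintegral_uStar_etaStar (hθ : A.regenTransform θ = 1) :
    1 ≤ ∫⁻ w, A.uStar θ w ∂A.etaStar θ := by
  rw [← hθ, ← mul_etaStar_univ, ← lintegral_const]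
  exact lintegral_mono fun x => A.le_uStar θ x

lemma lintegral_uStar_etaStar_lt_top (hθ : A.regenTransform θ = 1) :
    ∫⁻ w, A.uStar θ w ∂A.etaStar θ < ∞ := by
  refine (lintegral_mono fun x => A.uStar_le hθ x).trans_lt ?_
  rw [lintegral_const]
  exact ENNReal.mul_lt_top A.uStar_bound_ne_top.lt_top (A.etaStar_univ_lt_top hθ)

lemma measurable_uStar_toReal (θ : ℝ) : Measurable fun x => (A.uStar θ x).toReal :=
  (A.measurable_uStar θ).ennreal_toReal

lemma integral_uStar_toReal (hθ : A.regenTransform θ = 1) (μ : Measure S) :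
    ∫ x, (A.uStar θ x).toReal ∂μ = (∫⁻ x, A.uStar θ x ∂μ).toReal :=
  integral_toReal (A.measurable_uStar θ).aemeasurable
    (Eventually.of_forall fun x => (A.uStar_ne_top hθ x).lt_top)

lemma exp_mul_integral_uStar (hθ : A.regenTransform θ = 1) (x : S) :
    Real.exp θ * ∫ y, (A.uStar θ y).toReal ∂(D.B ^ D.m) x = (A.uStar θ x).toReal := by
  rw [A.integral_uStar_toReal hθ, A.uStar_eq_lintegral_pow hθ x, ENNReal.toReal_mul,
    ENNReal.toReal_ofReal (Real.exp_nonneg _)]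

lemma uStar_toReal_le (hθ : A.regenTransform θ = 1) (x : S) :
    (A.uStar θ x).toReal ≤ Real.exp θ * (A.ratio * A.delta.toReal) := by
  have h := ENNReal.toReal_mono A.uStar_bound_ne_top (A.uStar_le hθ x)
  rwa [ENNReal.toReal_mul, ENNReal.toReal_mul, ENNReal.toReal_ofReal (Real.exp_nonneg _),
    ENNReal.toReal_ofReal A.ratio_pos.le] at h

lemma le_uStar_toReal (hθ : A.regenTransform θ = 1) (x : S) :
    Real.exp θ * A.delta.toReal ≤ (A.uStar θ x).toReal := by
  have h := ENNReal.toReal_mono (A.uStar_ne_top hθ x) (A.le_uStar θ x)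
  rwa [ENNReal.toReal_mul, ENNReal.toReal_ofReal (Real.exp_nonneg _)] at h

/-- Uniform geometric convergence of `e^{θ k} B ^ {k m}`. -/
lemma exists_geometric_bound (hθ : A.regenTransform θ = 1) :
    ∃ ρ : ℝ, 0 ≤ ρ ∧ ρ < 1 ∧ ∀ (f : S → ℝ) (b : ℝ), Measurable f → (∀ x, |f x| ≤ b) →
      ∃ C : ℝ, ∀ (k : ℕ) (x : S),
        |Real.exp θ ^ k * ∫ y, f y ∂((D.B ^ D.m) ^ k) x -
          (∫ y, f y ∂A.etaStar θ) / (∫⁻ w, A.uStar θ w ∂A.etaStar θ).toReal *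
            (A.uStar θ x).toReal| ≤ C * ρ ^ k := by
  have hδ : 0 < A.delta.toReal := ENNReal.toReal_pos A.delta_ne_zero A.delta_ne_top
  have hs : 0 < Real.exp θ := Real.exp_pos θ
  have hH : Real.exp θ * A.delta.toReal ≤ Real.exp θ * (A.ratio * A.delta.toReal) :=
    (A.le_uStar_toReal hθ A.v).trans (A.uStar_toReal_le hθ A.v)
  have hH0 : 0 < Real.exp θ * (A.ratio * A.delta.toReal) := (mul_pos hs hδ).trans_le hH
  have hη : IsFiniteMeasure (A.etaStar θ) := ⟨A.etaStar_univ_lt_top hθ⟩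
  -- This rate is `1 - c₁ / c₂`; it does not depend on `f`.
  refine ⟨1 - Real.exp θ * A.delta.toReal / (Real.exp θ * (A.ratio * A.delta.toReal)),
    sub_nonneg.2 ((div_le_one hH0).2 hH), sub_lt_self _ (div_pos (mul_pos hs hδ) hH0),
    fun f b hf hb => ?_⟩
  rw [← A.integral_uStar_toReal hθ]
  refine exists_forall_abs_pow_integral_sub_le (ψ := A.psi) (fun x => pow_le_one _ x) hs hδ ?_ ?_
    (A.measurable_uStar_toReal θ) (A.le_uStar_toReal hθ) (A.uStar_toReal_le hθ) hH
    (A.exp_mul_integral_uStar hθ) ?_ (A.smul_etaStar_bind hθ) hf hb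
  · rw [A.integral_uStar_toReal hθ]
    exact ENNReal.toReal_pos (one_pos.trans_le (A.one_le_lintegral_uStar_etaStar hθ)).ne'
      (A.lintegral_uStar_etaStar_lt_top hθ).ne
  · intro x
    rw [ENNReal.ofReal_toReal A.delta_ne_top]
    exact A.delta_smul_psi_le x
  · rw [A.integral_uStar_toReal hθ, lintegral_uStar_psi, hθ, ENNReal.toReal_one]

/-- `u_*` is an eigenfunction of `B` itself. -/
lemma integral_uStar (hθ : A.regenTransform θ = 1) (x : S) :
    ∫ y, (A.uStar θ y).toReal ∂D.B x = Real.exp (-θ / D.m) * (A.uStar θ x).toReal := by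
  set h : S → ℝ := fun x => (A.uStar θ x).toReal with hh
  set H := Real.exp θ * (A.ratio * A.delta.toReal) with hH
  have hs : 0 < Real.exp θ := Real.exp_pos θ
  have hm : Measurable h := A.measurable_uStar_toReal θ
  have hpos : ∀ x, 0 < h x := fun x =>
    ENNReal.toReal_pos (A.uStar_pos θ x).ne' (A.uStar_ne_top hθ x)
  have hhb : ∀ x, |h x| ≤ H := fun x => by
    rw [abs_of_nonneg (hpos x).le]; exact A.uStar_toReal_le hθ x
  have hH0 : 0 ≤ H := (abs_nonneg _).trans (hhb A.v)
  have hfin : ∀ x, IsFiniteMeasure (D.B x) := fun x =>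
    ⟨(D.B_le_one x).trans_lt ENNReal.one_lt_top⟩
  set g : S → ℝ := fun x => ∫ y, h y ∂D.B x with hg
  have hgm : Measurable g := (hm.stronglyMeasurable.integral_kernel (κ := D.B)).measurable
  have hgb : ∀ x, |g x| ≤ H := by
    intro x
    have h1 := norm_integral_le_of_norm_le_const (μ := D.B x) (f := h) (C := H)
      (Eventually.of_forall hhb)
    have h2 : (D.B x).real Set.univ ≤ 1 :=
      ENNReal.toReal_le_of_le_ofReal zero_le_one (by simpa using D.B_le_one x)
    exact h1.trans (mul_le_of_le_one_right hH0 h2)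
  -- `g = B u_*` inherits the eigenvalue because `B` commutes with `B ^ m`.
  have hcomm : ∀ x, ∫ y, g y ∂(D.B ^ D.m) x = (Real.exp θ)⁻¹ * g x := by
    intro x
    have hf1 := isFiniteMeasure_pow D (D.m + 1) x
    have hi : Integrable h ((D.B ^ (D.m + 1)) x) := integrable_of_abs_le hm hhb
    have e1 : ∫ y, h y ∂(D.B ^ (D.m + 1)) x = ∫ y, g y ∂(D.B ^ D.m) x := by
      rw [pow_succ'] at hi ⊢
      exact Kernel.integral_comp hi
    have e2 : ∫ y, h y ∂(D.B ^ (D.m + 1)) x = ∫ z, ∫ y, h y ∂(D.B ^ D.m) z ∂D.B x := by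
      rw [pow_succ] at hi ⊢
      exact Kernel.integral_comp hi
    have e3 : ∀ z, ∫ y, h y ∂(D.B ^ D.m) z = (Real.exp θ)⁻¹ * h z := by
      intro z
      rw [eq_inv_mul_iff_mul_eq₀ hs.ne']
      exact A.exp_mul_integral_uStar hθ z
    rw [← e1, e2]
    simp_rw [e3]
    rw [integral_const_mul]
  obtain ⟨ρ, hρ0, hρ1, hρ⟩ := A.exists_geometric_bound hθ
  obtain ⟨C, hC⟩ := hρ g H hgm hgb
  set β := (∫ y, g y ∂A.etaStar θ) / (∫⁻ w, A.uStar θ w ∂A.etaStar θ).toReal with hβ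
  have hβ0 : 0 ≤ β := div_nonneg (integral_nonneg fun x => integral_nonneg fun y => (hpos y).le)
    ENNReal.toReal_nonneg
  -- For the eigenfunction `g` the normalized iterates equal `g` for every `k`, so convergence to `β
  -- h` forces equality.
  have hgβ : ∀ x, g x = β * h x := by
    intro x
    have hk : ∀ k : ℕ, |g x - β * h x| ≤ C * ρ ^ k := by
      intro k
      have := hC k x
      rwa [kernel_pow_integral_eq_of_eigen (pow_pow_le_one D) hgm hgb hcomm, ← mul_assoc,
        ← mul_pow, mul_inv_cancel₀ hs.ne', one_pow, one_mul] at this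
    have hlim : Tendsto (fun k : ℕ => C * ρ ^ k) atTop (nhds (C * 0)) :=
      (tendsto_pow_atTop_nhds_zero_of_lt_one hρ0 hρ1).const_mul C
    rw [mul_zero] at hlim
    have := ge_of_tendsto' hlim hk
    exact sub_eq_zero.1 (abs_nonpos_iff.1 this)
  have hβm : β ^ D.m = (Real.exp θ)⁻¹ := by
    have e := kernel_pow_integral_eq_of_eigen (fun k x => pow_le_one k x) hm hhb hgβ D.m A.v
    have e2 := A.exp_mul_integral_uStar hθ A.v
    have e3 : Real.exp θ * (β ^ D.m * h A.v) = h A.v := by rw [← e]; exact e2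
    rw [← mul_assoc] at e3
    exact eq_inv_of_mul_eq_one_right (mul_right_cancel₀ (hpos A.v).ne' (e3.trans (one_mul _).symm))
  have hm0 : D.m ≠ 0 := by have := D.one_le_m; omega
  have hβe : β = Real.exp (-θ / D.m) := by
    refine (pow_left_inj₀ hβ0 (Real.exp_nonneg _) hm0).1 ?_
    rw [hβm, ← Real.exp_nat_mul, mul_div_cancel₀ _ (Nat.cast_ne_zero.2 hm0), Real.exp_neg]
  rw [← hβe]
  exact hgβ x

/-- The normalized `n`-step kernel converges. -/
lemma tendsto_exp_mul_pow (hθ0 : 0 ≤ θ) (hθ : A.regenTransform θ = 1) (x : S) {C : Set S}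
    (hC : MeasurableSet C) :
    Tendsto (fun n : ℕ => ((D.B ^ n) x C).toReal / Real.exp (-θ / D.m) ^ n) atTop
      (nhds ((A.uStar θ x).toReal * (A.etaStar θ C).toReal /
        (∫⁻ w, A.uStar θ w ∂A.etaStar θ).toReal)) := by
  set h : S → ℝ := fun x => (A.uStar θ x).toReal with hh
  set H := Real.exp θ * (A.ratio * A.delta.toReal) with hH
  set β := Real.exp (-θ / D.m) with hβ
  have hs : 0 < Real.exp θ := Real.exp_pos θ
  have hβ0 : 0 < β := Real.exp_pos _
  have hm0 : 0 < D.m := D.one_le_m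
  have hβ1 : β ≤ 1 := Real.exp_le_one_iff.2
    (div_nonpos_of_nonpos_of_nonneg (neg_nonpos.2 hθ0) (Nat.cast_nonneg _))
  have hβm : Real.exp θ * β ^ D.m = 1 := by
    rw [hβ, ← Real.exp_nat_mul, mul_div_cancel₀ _ (Nat.cast_ne_zero.2 hm0.ne'), ← Real.exp_add,
      add_neg_cancel, Real.exp_zero]
  have hm : Measurable h := A.measurable_uStar_toReal θ
  have hhb : ∀ x, |h x| ≤ H := fun x => by
    rw [abs_of_nonneg ENNReal.toReal_nonneg]; exact A.uStar_toReal_le hθ x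
  set f : S → ℝ := C.indicator 1 with hf
  have hfm : Measurable f := measurable_one.indicator hC
  have hfb : ∀ x, |f x| ≤ 1 := by
    intro x
    by_cases hx : x ∈ C <;> simp [hf, hx]
  have hfint : ∀ μ : Measure S, ∫ y, f y ∂μ = (μ C).toReal := fun μ =>
    integral_indicator_one hC
  obtain ⟨ρ, hρ0, hρ1, hρ⟩ := A.exists_geometric_bound hθ
  obtain ⟨K, hK⟩ := hρ f 1 hfm hfb
  rw [hfint] at hK
  set c := (A.etaStar θ C).toReal / (∫⁻ w, A.uStar θ w ∂A.etaStar θ).toReal with hc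
  have hK0 : 0 ≤ K := by simpa using (abs_nonneg _).trans (hK 0 x)
  -- The `r` single steps come first: the estimate for the `q` blocks is uniform in their starting
  -- point, and `B ^ r` multiplies `u_*` by `β ^ r`.
  have hbound : ∀ q r : ℕ, |Real.exp θ ^ q * ((D.B ^ (D.m * q + r)) x C).toReal -
      c * (β ^ r * h x)| ≤ K * ρ ^ q := by
    intro q r
    have hfr := isFiniteMeasure_pow D r x
    have hfn := isFiniteMeasure_pow D (D.m * q + r) x
    have e1 : ((D.B ^ (D.m * q + r)) x C).toReal =
        ∫ z, ∫ y, f y ∂((D.B ^ D.m) ^ q) z ∂(D.B ^ r) x := by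
      have hi : Integrable f ((D.B ^ (D.m * q + r)) x) := integrable_of_abs_le hfm hfb
      rw [← hfint]
      rw [_root_.pow_add, pow_mul] at hi ⊢
      exact Kernel.integral_comp hi
    have e2 : β ^ r * h x = ∫ z, h z ∂(D.B ^ r) x :=
      (kernel_pow_integral_eq_of_eigen (fun k x => pow_le_one k x) hm hhb
        (A.integral_uStar hθ) r x).symm
    have hFm : Measurable fun z => ∫ y, f y ∂((D.B ^ D.m) ^ q) z :=
      (hfm.stronglyMeasurable.integral_kernel (κ := (D.B ^ D.m) ^ q)).measurable
    have hFb : ∀ z, |∫ y, f y ∂((D.B ^ D.m) ^ q) z| ≤ 1 := by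
      intro z
      rw [hfint, abs_of_nonneg ENNReal.toReal_nonneg]
      refine ENNReal.toReal_le_of_le_ofReal zero_le_one ?_
      rw [ENNReal.ofReal_one]
      exact (measure_mono (Set.subset_univ _)).trans (pow_pow_le_one D q z)
    have i1 : Integrable (fun z => Real.exp θ ^ q * ∫ y, f y ∂((D.B ^ D.m) ^ q) z)
        ((D.B ^ r) x) := (integrable_of_abs_le hFm hFb).const_mul _
    have i2 : Integrable (fun z => c * h z) ((D.B ^ r) x) :=
      (integrable_of_abs_le hm hhb).const_mul _
    rw [e1, e2, ← integral_const_mul, ← integral_const_mul, ← integral_sub i1 i2]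
    refine (norm_integral_le_of_norm_le_const (C := K * ρ ^ q)
      (f := fun z => Real.exp θ ^ q * ∫ y, f y ∂((D.B ^ D.m) ^ q) z - c * h z)
      (Eventually.of_forall fun z => hK q z)).trans ?_
    refine mul_le_of_le_one_right (mul_nonneg hK0 (pow_nonneg hρ0 q)) ?_
    exact ENNReal.toReal_le_of_le_ofReal zero_le_one
      (by simpa using pow_le_one (D := D) r x)
  have hlimit : (A.uStar θ x).toReal * (A.etaStar θ C).toReal /
      (∫⁻ w, A.uStar θ w ∂A.etaStar θ).toReal = c * h x := by
    rw [hc, hh]; ring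
  rw [hlimit, tendsto_iff_norm_sub_tendsto_zero]
  have hdiv : Tendsto (fun n : ℕ => n / D.m) atTop atTop := Nat.tendsto_div_const_atTop hm0.ne'
  have hlim : Tendsto (fun n : ℕ => Real.exp θ * (K * ρ ^ (n / D.m))) atTop
      (nhds (Real.exp θ * (K * 0))) :=
    (((tendsto_pow_atTop_nhds_zero_of_lt_one hρ0 hρ1).comp hdiv).const_mul K).const_mul _
  rw [mul_zero, mul_zero] at hlim
  refine squeeze_zero (fun n => norm_nonneg _) (fun n => ?_) hlim
  have hb := hbound (n / D.m) (n % D.m)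
  rw [Nat.div_add_mod] at hb
  have hβn : Real.exp θ ^ (n / D.m) * β ^ n = β ^ (n % D.m) := by
    conv_lhs => rw [← Nat.div_add_mod n D.m, _root_.pow_add, pow_mul, Nat.div_add_mod n D.m,
      ← mul_assoc, ← mul_pow, hβm, one_pow, one_mul]
  have hr0 : 0 < β ^ (n % D.m) := pow_pos hβ0 _
  -- Dividing by `β ^ r` costs at most `e^θ`, since `r < m` and `β ≤ 1`; the latter uses `θ ≥ 0`.
  have hrle : 1 ≤ Real.exp θ * β ^ (n % D.m) := by
    rw [← hβm]
    exact mul_le_mul_of_nonneg_left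
      (pow_le_pow_of_le_one hβ0.le hβ1 (Nat.mod_lt n hm0).le) hs.le
  have hid : ((D.B ^ n) x C).toReal / β ^ n - c * h x =
      (Real.exp θ ^ (n / D.m) * ((D.B ^ n) x C).toReal - c * (β ^ (n % D.m) * h x)) /
        β ^ (n % D.m) := by
    have hn0 : β ^ n ≠ 0 := (pow_pos hβ0 n).ne'
    have hq0 : Real.exp θ ^ (n / D.m) ≠ 0 := (pow_pos hs _).ne'
    rw [sub_div, ← hβn]
    field_simp
  rw [hid, Real.norm_eq_abs, abs_div, abs_of_pos hr0, div_le_iff₀ hr0]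
  calc _ ≤ K * ρ ^ (n / D.m) := hb
    _ ≤ K * ρ ^ (n / D.m) * (Real.exp θ * β ^ (n % D.m)) :=
      le_mul_of_one_le_right (mul_nonneg hK0 (pow_nonneg hρ0 _)) hrle
    _ = _ := by ring

end UniformComparison
end

/-! ### The theorem. -/

theorem theorem7 {S : Type*} [MetricSpace S] [MeasurableSpace S] [BorelSpace S]
    (D : DensityKernel S) (A : UniformComparison D) :
    (∃ θ : ℝ, 0 ≤ θ ∧ A.regenTransform θ = 1 ∧ A.regenMean θ < ∞) ∧
    ∀ θ : ℝ, 0 ≤ θ → A.regenTransform θ = 1 →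
      (∀ x, 0 < A.uStar θ x ∧ A.uStar θ x < ∞) ∧
      A.etaStar θ Set.univ < ∞ ∧
      0 < ∫⁻ w, A.uStar θ w ∂A.etaStar θ ∧
      ∫⁻ w, A.uStar θ w ∂A.etaStar θ < ∞ ∧
      ∀ (x : S) (C : Set S), MeasurableSet C → 0 < A.etaStar θ C →
        (fun n : ℕ => ((D.B ^ n) x C).toReal) ~[atTop]
          (fun n : ℕ => UniformComparison.lambdaStar θ ^ ((n : ℝ) / (D.m : ℝ)) *
            ((A.uStar θ x).toReal * (A.etaStar θ C).toReal /
              (∫⁻ w, A.uStar θ w ∂A.etaStar θ).toReal)) := by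
  refine ⟨A.exists_regenTransform_eq_one, fun θ hθ0 hθ => ?_⟩
  refine ⟨fun x => ⟨A.uStar_pos θ x, (A.uStar_ne_top hθ x).lt_top⟩, A.etaStar_univ_lt_top hθ,
    one_pos.trans_le (A.one_le_lintegral_uStar_etaStar hθ), A.lintegral_uStar_etaStar_lt_top hθ,
    fun x C hC hpos => ?_⟩
  -- A nonzero limit, available because `η_*(C) > 0`, turns convergence of the normalized kernel
  -- into asymptotic equivalence.
  have hL : 0 < (A.uStar θ x).toReal * (A.etaStar θ C).toReal /
      (∫⁻ w, A.uStar θ w ∂A.etaStar θ).toReal := by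
    refine div_pos (mul_pos (ENNReal.toReal_pos (A.uStar_pos θ x).ne' (A.uStar_ne_top hθ x))
      (ENNReal.toReal_pos hpos.ne' ?_)) (ENNReal.toReal_pos
        (one_pos.trans_le (A.one_le_lintegral_uStar_etaStar hθ)).ne'
        (A.lintegral_uStar_etaStar_lt_top hθ).ne)
    exact ((measure_mono (Set.subset_univ C)).trans_lt (A.etaStar_univ_lt_top hθ)).ne
  set L := (A.uStar θ x).toReal * (A.etaStar θ C).toReal /
    (∫⁻ w, A.uStar θ w ∂A.etaStar θ).toReal with hLdef
  have hpow : ∀ n : ℕ, UniformComparison.lambdaStar θ ^ ((n : ℝ) / (D.m : ℝ)) =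
      Real.exp (-θ / D.m) ^ n := by
    intro n
    rw [UniformComparison.lambdaStar, ← Real.exp_mul, ← Real.exp_nat_mul]
    ring_nf
  simp_rw [hpow]
  have hlim := (A.tendsto_exp_mul_pow hθ0 hθ x hC).div_const L
  rw [← hLdef, div_self hL.ne'] at hlim
  rw [isEquivalent_iff_tendsto_one
    (Eventually.of_forall fun n => (mul_pos (pow_pos (Real.exp_pos _) n) hL).ne')]
  refine hlim.congr fun n => ?_
  simp only [Pi.div_apply]
  rw [div_div]
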